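/- Let $\mathbb D$ be the open unit disc. For $1\le p<\infty$ let $A^p$ be the Bergman space of all analytic functions $f$ on $\mathbb D$ with $\|f\|_{A^p}=\left(\int_{\mathbb D}|f|^p\,dA\right)^{1/p}<\infty$, where $dA=dx\,dy/\pi$. Let $\mu$ be a Borel probability measure on $[0,1)$ and put $$\Gamma_\mu(f)(z)=\int_0^1 \frac{1}{1+(t-1)z}\,f\!\left(\frac{t}{1+(t-1)z}\right)d\mu(t),\qquad z\in\mathbb D.$$ We say that $\Gamma_\mu$ is bounded on $A^p$ if for each $f\in A^p$ this integral converges for every $z\in\mathbb D$ and $f\mapsto\Gamma_\mu(f)$ is a bounded linear operator from $A^p$ to $A^p$. The essential norm of a bounded operator $T$ on $A^p$ is $\|T\|_{e,A^p}=\inf\{\|T-K\| : K \text{ a compact operator on } A^p\}$. Theorem. Let $1<p<\infty$. If $\Gamma_\mu$ is bounded on $A^p$, then $$\|\Gamma_\mu\|_{e,A^p}=\int_0^1\frac{t^{2/p-1}}{(1-t)^{2/p}}\,d\mu(t)$$ (in particular the integral is finite). Consequently, $\Gamma_\mu$ is not a compact operator on $A^p$ for any $\mu$ if $2\le p<\infty$;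 and if $1<p<2$, then $\Gamma_\mu$ is a (bounded and) compact operator on $A^p$ if and only if $\mu=\delta_0$, the Dirac point mass at $0$. -/

import Mathlib

open MeasureTheory Set Filter
open scoped ENNReal

noncomputable section

/-- The normalized area measure `dA = dx dy / π` on the open unit disc of `ℂ`. -/
def discArea : Measure ℂ :=
  (ENNReal.ofReal Real.pi)⁻¹ • volume.restrict (Metric.ball (0 : ℂ) 1)

/-- The Bergman space `A^p` of the unit disc, as a subspace of `L^p(𝔻, dA)`: the elements of `L^p`
that are represented by a function analytic in the disc. It carries the norm of `L^p(𝔻, dA)`. -/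
def BergmanSpace (p : ℝ≥0∞) [Fact (1 ≤ p)] : Submodule ℂ (Lp ℂ p discArea) where
  carrier := {f | ∃ F : ℂ → ℂ, DifferentiableOn ℂ F (Metric.ball 0 1) ∧ f =ᵐ[discArea] F}
  zero_mem' := ⟨0, differentiableOn_const 0, Lp.coeFn_zero _ _ _⟩
  add_mem' := by
    rintro f g ⟨F, hF, hfF⟩ ⟨G, hG, hgG⟩
    exact ⟨F + G, hF.add hG, (Lp.coeFn_add f g).trans (hfF.add hgG)⟩
  smul_mem' := by
    rintro c f ⟨F, hF, hfF⟩
    exact ⟨c • F, hF.const_smul c, (Lp.coeFn_smul c f).trans (hfF.const_smul c)⟩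

/-- The analytic function on the disc that an element of `A^p` is; only its values in the open unit
disc are meaningful, and there it is unique, see `bergmanEval_eq`. -/
def bergmanEval {p : ℝ≥0∞} [Fact (1 ≤ p)] (f : BergmanSpace p) : ℂ → ℂ :=
  Classical.choose f.2

theorem differentiableOn_bergmanEval {p : ℝ≥0∞} [Fact (1 ≤ p)] (f : BergmanSpace p) :
    DifferentiableOn ℂ (bergmanEval f) (Metric.ball 0 1) :=
  (Classical.choose_spec f.2).1

theorem ae_eq_bergmanEval {p : ℝ≥0∞} [Fact (1 ≤ p)] (f : BergmanSpace p) :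
    (f : Lp ℂ p discArea) =ᵐ[discArea] bergmanEval f :=
  (Classical.choose_spec f.2).2

theorem bergmanEval_eq {p : ℝ≥0∞} [Fact (1 ≤ p)] (f : BergmanSpace p) {F : ℂ → ℂ}
    (hF : DifferentiableOn ℂ F (Metric.ball 0 1)) (hfF : (f : Lp ℂ p discArea) =ᵐ[discArea] F) :
    EqOn (bergmanEval f) F (Metric.ball 0 1) := by
  have h : bergmanEval f =ᵐ[discArea] F := (ae_eq_bergmanEval f).symm.trans hfF
  have h' : bergmanEval f =ᵐ[volume.restrict (Metric.ball (0 : ℂ) 1)] F := by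
    have hc : (ENNReal.ofReal Real.pi)⁻¹ ≠ 0 := by simp
    exact (Measure.absolutelyContinuous_smul hc).ae_eq h
  exact Measure.eqOn_open_of_ae_eq h' Metric.isOpen_ball
    (differentiableOn_bergmanEval f).continuousOn hF.continuousOn

/-- The weighted composition operator
`T_t f (z) = 1 / (1 + (t - 1) z) * f (t / (1 + (t - 1) z))`. -/
def weightedComp (t : ℝ) (f : ℂ → ℂ) (z : ℂ) : ℂ :=
  1 / (1 + ((t : ℂ) - 1) * z) * f ((t : ℂ) / (1 + ((t : ℂ) - 1) * z))

/-- `Γ_μ f (z) = ∫ T_t f (z) dμ(t)`, where `μ` lives on `[0, 1)`. -/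
def gammaTransform (μ : Measure ℝ) (f : ℂ → ℂ) (z : ℂ) : ℂ :=
  ∫ t, weightedComp t f z ∂μ

/-- The bounded linear operator `T` on `A^p` is `Γ_μ`: for every `f` in `A^p` the integral that
defines `Γ_μ f (z)` converges at each point `z` of the disc, and its value is `T f (z)`.
Thus "`Γ_μ` is bounded on `A^p`" means that such a `T` exists (it is then unique). -/
def IsGammaOperator (p : ℝ≥0∞) [Fact (1 ≤ p)] (μ : Measure ℝ)
    (T : BergmanSpace p →L[ℂ] BergmanSpace p) : Prop :=
  ∀ f : BergmanSpace p, ∀ z ∈ Metric.ball (0 : ℂ) 1,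
    Integrable (fun t : ℝ => weightedComp t (bergmanEval f) z) μ ∧
      bergmanEval (T f) z = gammaTransform μ (bergmanEval f) z

/-- The essential norm of a bounded operator: its distance to the compact operators. -/
def essentialNorm {X : Type*} [NormedAddCommGroup X] [NormedSpace ℂ X] (T : X →L[ℂ] X) : ℝ :=
  sInf {r : ℝ | ∃ K : X →L[ℂ] X, IsCompactOperator K ∧ r = ‖T - K‖}

end

/-! Write `q` for the real exponent, `T_t` for the weighted composition operator with symbol `φ_t(z)
= t/v`, where `v = 1 + (t-1)z`, and `H` for the integral of `gammaWeight q`. The norms of the `T_t`,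
integrated against `μ`, give `H` once a compact operator is subtracted, and functions concentrating
at the common fixed point `1` of the `φ_t` show that nothing smaller is possible.

Upper bound. The substitution `w = φ_t(z)` turns `‖T_t F‖^q` into `gammaWeight q t ^ q` times the
integral of `|w|^(q-4) |F|^q` over `φ_t(𝔻)` (`eLpNorm_weightedComp_rpow_le`). For `t > 0` these
images lie in the disc with diameter `(0, 1)`, which reaches the unit circle only at `1`. The weight
may blow up at `0`, so `f` is replaced by `f - (1 - w^4) S f = w^4 f + (1 - w^4)(f - S f)` with `S`
of finite rank and close to the identity on compact sets. The first summand costs at most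
`gammaWeight q t * ‖f‖`, as `w^4` absorbs the singularity. The second is negligible relative to that
weight, uniformly in `t`: `1 - w^4` vanishes at `1`, `f - S f` is small away from the circle, and it
vanishes at `0`, which together with `q > 1` handles the singularity
(`exists_eLpNorm_weightedComp_one_sub_pow_four_mul_le`). Minkowski's inequality integrates this over
`μ`.

Lower bound. For `f_a = (1-z)^(-a)` one has `T_t f_a = f_a (1-t)^(-a) v^(a-1)`
(`weightedComp_testFun`). For `0 ≤ a ≤ 2` the last factor has nonnegative real part, and as `a ↑
2/q` and `z → 1` Fatou's lemma gives `|Γ_μ f_a| ≥ M |f_a|` near `1` for every `M < H`. The norms of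
the `f_a` tend to infinity, so after normalization their mass concentrates at `1`. A compact `K`
sends a subsequence of the normalized functions to `0`, by a gliding hump argument
(`eq_zero_of_tendsto_map`) that avoids weak convergence. Hence `‖T - K‖ ≥ H` for every compact `K`;
boundedness of `T` alone makes `H` finite.

If `T` is compact, the choice `K = T` gives `H = 0`, whereas the weight is positive on `[0, 1)`
except at `t = 0` when `q < 2`. -/

noncomputable section

open Metric Topology

/-! ### Change of variables and power integrals on the disc -/

/-- Change of variables for an injective holomorphic map of the plane. -/
theorem setLIntegral_image_of_hasDerivAt {s : Set ℂ} (hs : MeasurableSet s) {φ φ' : ℂ → ℂ}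
    (hφ : ∀ z ∈ s, HasDerivAt φ (φ' z) z) (hinj : InjOn φ s) (g : ℂ → ℝ≥0∞) :
    ∫⁻ w in φ '' s, g w = ∫⁻ z in s, ‖φ' z‖ₑ ^ 2 * g (φ z) := by
  have h := lintegral_image_eq_lintegral_abs_det_fderiv_mul (volume : Measure ℂ) hs
    (f := φ) (f' := fun z => ((ContinuousLinearMap.toSpanSingleton ℂ (φ' z)).restrictScalars ℝ))
    (fun z hz => ((hφ z hz).hasFDerivAt.restrictScalars ℝ).hasFDerivWithinAt) hinj g
  rw [h]
  refine lintegral_congr fun z => ?_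
  congr 1
  have : (ContinuousLinearMap.toSpanSingleton ℂ (φ' z)).restrictScalars ℝ =
      ((LinearMap.toContinuousLinearMap (LinearMap.mul ℝ ℂ (φ' z))) : ℂ →L[ℝ] ℂ) := by
    ext <;> simp [mul_comm]
  rw [this]
  have hdet : (LinearMap.mul ℝ ℂ (φ' z)).det = ‖φ' z‖ ^ 2 := by
    rw [← Complex.normSq_eq_norm_sq, ← LinearMap.det_toMatrix Complex.basisOneI]
    have hM : LinearMap.toMatrix Complex.basisOneI Complex.basisOneI (LinearMap.mul ℝ ℂ (φ' z)) =
        !![(φ' z).re, -(φ' z).im; (φ' z).im, (φ' z).re] := by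
      ext i j
      (fin_cases i <;> fin_cases j) <;> simp [LinearMap.toMatrix_apply]
    rw [hM, Matrix.det_fin_two_of, Complex.normSq_apply]
    ring
  rw [LinearMap.det_toContinuousLinearMap, hdet, abs_of_nonneg (by positivity),
    ← ofReal_norm, ENNReal.ofReal_pow (norm_nonneg _)]

theorem lintegral_ball_norm_rpow_lt_top {s : ℝ} (hs : -2 < s) (R : ℝ) :
    ∫⁻ u in ball (0 : ℂ) R, ENNReal.ofReal (‖u‖ ^ s) < ∞ := by
  have h : IntegrableOn (fun u : ℂ => ‖u‖ ^ s) (ball 0 R) volume := by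
    rw [integrableOn_fun_norm_addHaar (volume : Measure ℂ) (f := fun y : ℝ => y ^ s)]
    have h1 : IntegrableOn (fun y : ℝ => y ^ (1 + s)) (Ioo 0 R) :=
      by
      rcases le_or_gt R 0 with hR | hR
      · simp [Ioo_eq_empty_of_le hR]
      · exact (intervalIntegral.integrableOn_Ioo_rpow_iff hR).2 (by linarith)
    refine h1.congr_fun (fun y hy => ?_) measurableSet_Ioo
    simp [Complex.finrank_real_complex, Real.rpow_add hy.1]
  have := h.lintegral_lt_top
  simpa using this

theorem lintegral_ball_one_sub_norm_rpow_lt_top {s : ℝ} (hs : -2 < s) :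
    ∫⁻ z in ball (0 : ℂ) 1, ENNReal.ofReal (‖1 - z‖ ^ s) < ∞ := by
  have h := lintegral_ball_norm_rpow_lt_top hs 2
  have h2 := setLIntegral_image_of_hasDerivAt (measurableSet_ball (x := (0:ℂ)) (ε := 1))
    (φ := fun z => 1 - z) (φ' := fun _ => -1)
    (fun z _ => by simpa using (hasDerivAt_id z).const_sub 1)
    (fun x _ y _ hxy => by simpa using hxy) (fun u => ENNReal.ofReal (‖u‖ ^ s))
  simp only [enorm_neg, enorm_one, one_pow, one_mul] at h2
  rw [← h2]
  refine (lintegral_mono_set ?_).trans_lt h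
  rintro _ ⟨z, hz, rfl⟩
  rw [mem_ball_zero_iff] at *
  exact (norm_sub_le _ _).trans_lt (by simp; linarith)

/-- The measure `|1 - z|^(-2) dA` is invariant under the contraction `c` by `1/2` towards `1`, which
maps the disc into itself. Were the integral finite, the disc minus its image would carry no mass;
but that difference contains a ball around `-1/2`. -/
theorem lintegral_ball_one_sub_norm_neg_two :
    ∫⁻ z in ball (0 : ℂ) 1, ENNReal.ofReal (‖1 - z‖ ^ (-2 : ℝ)) = ∞ := by
  by_contra hfin
  set c : ℂ → ℂ := fun z => 1 - (1 - z) / 2 with hc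
  set F : ℂ → ℝ≥0∞ := fun z => ENNReal.ofReal (‖1 - z‖ ^ (-2 : ℝ)) with hF
  have hinj : InjOn c (ball 0 1) := fun x _ y _ hxy => by
    simp only [hc] at hxy; linear_combination 2 * hxy
  have hcov := setLIntegral_image_of_hasDerivAt (measurableSet_ball (x := (0:ℂ)) (ε := 1))
    (φ := c) (φ' := fun _ => 1 / 2)
    (fun z _ => by
      have := (((hasDerivAt_id z).const_sub 1).div_const 2).const_sub 1
      convert! this using 1; norm_num) hinj F
  have heq : ∫⁻ w in c '' ball 0 1, F w = ∫⁻ z in ball (0:ℂ) 1, F z := by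
    rw [hcov]
    refine setLIntegral_congr_fun measurableSet_ball fun z hz => ?_
    simp only [hF, hc, sub_sub_cancel, norm_div, Complex.norm_ofNat]
    have hz1 : (1 : ℂ) - z ≠ 0 := by
      intro h
      have : z = 1 := by linear_combination -h
      rw [this] at hz; simp at hz
    rw [← ofReal_norm, ← ENNReal.ofReal_pow (norm_nonneg _),
      ← ENNReal.ofReal_mul (by positivity)]
    congr 1
    have : 0 < ‖1 - z‖ := norm_pos_iff.2 hz1
    rw [Real.rpow_neg (by positivity), Real.rpow_neg (by positivity)]
    norm_num
    field_simp
    norm_num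
  have hsub : c '' ball 0 1 ⊆ ball 0 1 := by
    rintro _ ⟨z, hz, rfl⟩
    rw [mem_ball_zero_iff] at *
    have : c z = 1 / 2 + z / 2 := by simp only [hc]; ring
    rw [this]
    refine (norm_add_le _ _).trans_lt ?_
    simp; linarith
  have hball : ball (-(1/2) : ℂ) (1/2) ⊆ ball 0 1 \ (c '' ball 0 1) := by
    intro w hw
    rw [mem_ball_iff_norm] at hw
    have hw' : ‖w‖ < 1 := by
      have := norm_sub_le (w - -(1/2)) (1/2)
      simp at this hw; linarith
    refine ⟨by simpa using hw', ?_⟩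
    rintro ⟨z, hz, rfl⟩
    rw [mem_ball_zero_iff] at hz
    have e : c z - -(1/2) = 1 - (-z/2) := by simp only [hc]; ring
    rw [e] at hw
    have := norm_sub_norm_le (1:ℂ) (-z/2)
    simp at this hw; linarith
  have hmeas : MeasurableSet (c '' ball 0 1) :=
    measurableSet_ball.image_of_continuousOn_injOn (by fun_prop) hinj
  have hsplit : ∫⁻ z in ball (0:ℂ) 1, F z =
      (∫⁻ z in c '' ball 0 1, F z) + ∫⁻ z in ball 0 1 \ c '' ball 0 1, F z := by
    have := lintegral_inter_add_sdiff (μ := volume) F (ball 0 1) hmeas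
    rw [inter_eq_right.2 hsub] at this
    exact this.symm
  replace hsplit := hsplit.trans (congrArg (· + _) heq)
  have hzero : ∫⁻ z in ball 0 1 \ c '' ball 0 1, F z = 0 := by
    have h0 : (∫⁻ z in ball (0:ℂ) 1, F z) + 0 = (∫⁻ z in ball (0:ℂ) 1, F z) +
      ∫⁻ z in ball 0 1 \ c '' ball 0 1, F z := by rw [add_zero]; exact hsplit
    exact ((ENNReal.add_right_inj hfin).1 h0).symm
  have hpos : 0 < ∫⁻ z in ball (-(1/2) : ℂ) (1/2), F z := by
    have h1 : ∫⁻ z in ball (-(1/2) : ℂ) (1/2), (ENNReal.ofReal (1/4)) ≤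
        ∫⁻ z in ball (-(1/2) : ℂ) (1/2), F z := by
      refine setLIntegral_mono' measurableSet_ball fun z hz => ENNReal.ofReal_le_ofReal ?_
      have hz0 := (hball hz).1
      rw [mem_ball_zero_iff] at hz0
      have hz1 : (1 : ℂ) - z ≠ 0 := by
        intro h
        have : z = 1 := by linear_combination -h
        rw [this] at hz0; simp at hz0
      have h2 : ‖1 - z‖ ≤ 2 := (norm_sub_le _ _).trans (by simp; linarith)
      have h3 : 0 < ‖1 - z‖ := norm_pos_iff.2 hz1
      rw [Real.rpow_neg (by positivity)]
      norm_num
      rw [inv_eq_one_div, div_le_div_iff₀ (by norm_num) (by positivity)]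
      nlinarith
    refine lt_of_lt_of_le ?_ h1
    rw [setLIntegral_const]
    refine ENNReal.mul_pos (by norm_num) ?_
    exact (measure_ball_pos _ _ (by norm_num)).ne'
  exact (hpos.trans_le (lintegral_mono_set hball)).ne' hzero

/-! ### Mean value and Minkowski inequalities, finite sums of compact operators -/

/-- The area mean value inequality. -/
theorem enorm_le_lintegral_ball {f : ℂ → ℂ} {w : ℂ} {R : ℝ} (hR : 0 < R)
    (hf : DifferentiableOn ℂ f (ball w R)) :
    ENNReal.ofReal (Real.pi * R ^ 2) * ‖f w‖ₑ ≤ ∫⁻ z in ball w R, ‖f z‖ₑ := by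
  have hcirc : ∀ r ∈ Ioo 0 R, ENNReal.ofReal (2 * Real.pi) * ‖f w‖ₑ ≤
      ∫⁻ θ in Ioo (-Real.pi) Real.pi, ‖f (circleMap w r θ)‖ₑ := by
    intro r hr
    have hsub : closedBall w |r| ⊆ ball w R := by
      rw [abs_of_pos hr.1]; exact closedBall_subset_ball hr.2
    have h1 : Real.circleAverage f w r = f w :=
      (hf.diffContOnCl_ball hsub).circleAverage
    rw [Real.circleAverage_eq_integral_add (-Real.pi),
      intervalIntegral.integral_comp_add_right (fun θ => f (circleMap w r θ)) (-Real.pi)] at h1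
    have h2 : ∫ θ in (-Real.pi)..Real.pi, f (circleMap w r θ) = (2 * Real.pi : ℝ) • f w := by
      rw [← h1, smul_smul, mul_inv_cancel₀ (by positivity), one_smul]
      congr 1 <;> ring
    have h3 : ENNReal.ofReal (2 * Real.pi) * ‖f w‖ₑ =
        ‖∫ θ in (-Real.pi)..Real.pi, f (circleMap w r θ)‖ₑ := by
      rw [h2, enorm_smul, Real.enorm_of_nonneg (by positivity)]
    rw [h3, intervalIntegral.integral_of_le (by linarith [Real.pi_pos]),
      integral_Ioc_eq_integral_Ioo]
    exact enorm_integral_le_lintegral_enorm _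
  have hpol : ∀ p : ℝ × ℝ, w + Complex.polarCoord.symm p = circleMap w p.1 p.2 := by
    intro p
    rw [Complex.polarCoord_symm_apply, circleMap, Complex.exp_mul_I]
    simp
  set G : ℂ → ℝ≥0∞ := (ball w R).indicator fun z => ‖f z‖ₑ with hG
  have hcont : ContinuousOn (fun p : ℝ × ℝ => ENNReal.ofReal p.1 * ‖f (circleMap w p.1 p.2)‖ₑ)
      (Ioo 0 R ×ˢ Ioo (-Real.pi) Real.pi) := by
    have hc : ContinuousOn (fun p : ℝ × ℝ => f (circleMap w p.1 p.2))
        (Ioo 0 R ×ˢ Ioo (-Real.pi) Real.pi) := by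
      refine hf.continuousOn.comp (t := ball w R) ?_ ?_
      · unfold circleMap; fun_prop
      · rintro p ⟨hp, -⟩
        simp [circleMap, abs_of_pos hp.1, hp.2]
    intro p hp
    refine ENNReal.Tendsto.mul ?_ (Or.inr (by simp)) ?_ (Or.inr (by simp))
    · exact (ENNReal.continuous_ofReal.comp continuous_fst).continuousWithinAt
    · exact (hc p hp).enorm
  calc ENNReal.ofReal (Real.pi * R ^ 2) * ‖f w‖ₑ
      = ∫⁻ r in Ioo 0 R, ENNReal.ofReal r * (ENNReal.ofReal (2 * Real.pi) * ‖f w‖ₑ) := by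
        rw [lintegral_mul_const _ (by fun_prop), ← mul_assoc]
        congr 1
        rw [← ofReal_integral_eq_lintegral_ofReal, ← ENNReal.ofReal_mul]
        · congr 1
          rw [← integral_Ioc_eq_integral_Ioo, ← intervalIntegral.integral_of_le hR.le,
            integral_id]
          ring
        · exact setIntegral_nonneg measurableSet_Ioo fun x hx => hx.1.le
        · exact (continuous_id.integrableOn_Icc).mono_set Ioo_subset_Icc_self
        · filter_upwards [ae_restrict_mem measurableSet_Ioo] with x hx using hx.1.le
    _ ≤ ∫⁻ r in Ioo 0 R, ∫⁻ θ in Ioo (-Real.pi) Real.pi,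
          ENNReal.ofReal r * ‖f (circleMap w r θ)‖ₑ := by
        refine setLIntegral_mono' measurableSet_Ioo fun r hr => ?_
        rw [lintegral_const_mul' _ _ ENNReal.ofReal_ne_top]
        exact mul_le_mul_right (hcirc r hr) _
    _ = ∫⁻ p in Ioo 0 R ×ˢ Ioo (-Real.pi) Real.pi,
          ENNReal.ofReal p.1 * ‖f (circleMap w p.1 p.2)‖ₑ := by
        rw [Measure.volume_eq_prod, setLIntegral_prod _
          (hcont.aemeasurable (measurableSet_Ioo.prod measurableSet_Ioo))]
    _ = ∫⁻ p in Ioo 0 R ×ˢ Ioo (-Real.pi) Real.pi,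
          ENNReal.ofReal p.1 • G (w + Complex.polarCoord.symm p) := by
        refine setLIntegral_congr_fun (measurableSet_Ioo.prod measurableSet_Ioo) fun p hp => ?_
        have hmem : circleMap w p.1 p.2 ∈ ball w R := by
          simp [circleMap, abs_of_pos hp.1.1, hp.1.2]
        simp only [hpol, hG, indicator_of_mem hmem, smul_eq_mul]
    _ ≤ ∫⁻ p in polarCoord.target, ENNReal.ofReal p.1 • G (w + Complex.polarCoord.symm p) :=
        lintegral_mono_set (prod_mono Ioo_subset_Ioi_self subset_rfl)
    _ = ∫⁻ u, G (w + u) := Complex.lintegral_comp_polarCoord_symm fun u => G (w + u)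
    _ = ∫⁻ z in ball w R, ‖f z‖ₑ := by
        rw [lintegral_add_left_eq_self, hG, lintegral_indicator measurableSet_ball]

/-- A weighted form of Minkowski's integral inequality. -/
theorem lintegral_lintegral_rpow_le {α β : Type*} [MeasurableSpace α] [MeasurableSpace β]
    {μ : Measure α} {ν : Measure β} [SFinite μ] [SFinite ν] {q : ℝ} (hq : 1 < q)
    {Φ : α → β → ℝ≥0∞} (hΦ : Measurable (Function.uncurry Φ)) {k : α → ℝ≥0∞} (hk : Measurable k)
    (hk0 : ∀ᵐ t ∂μ, k t ≠ 0) (hbound : ∀ᵐ t ∂μ, ∫⁻ z, Φ t z ^ q ∂ν ≤ k t ^ q)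
    (hfin : ∫⁻ t, k t ∂μ ≠ ∞) :
    ∫⁻ z, (∫⁻ t, Φ t z ∂μ) ^ q ∂ν ≤ (∫⁻ t, k t ∂μ) ^ q := by
  have hq0 : 0 < q := by linarith
  have hktop : ∀ᵐ t ∂μ, k t < ∞ := ae_lt_top hk hfin
  have hpow : ∀ t, k t ≠ 0 → k t < ∞ → ∀ a b : ℝ, k t ^ a * k t ^ b = k t ^ (a + b) :=
    fun t h0 h1 a b => (ENNReal.rpow_add a b h0 h1.ne).symm
  -- Hölder's inequality applied to `Φ = (Φ^q k^(1-q))^(1/q) * k^(1-1/q)`. Tonelli then finishes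
  -- without duality; cancelling the powers of `k` is what needs `k ≠ 0`.
  have hstep : ∀ z, (∫⁻ t, Φ t z ∂μ) ^ q ≤
      (∫⁻ t, Φ t z ^ q * k t ^ (1 - q) ∂μ) * (∫⁻ t, k t ∂μ) ^ (q - 1) := by
    intro z
    have hΦz : Measurable fun t => Φ t z := hΦ.comp (measurable_id.prodMk measurable_const)
    have h1 : ∫⁻ t, Φ t z ∂μ =
        ∫⁻ t, (Φ t z ^ q * k t ^ (1 - q)) ^ (1 / q) * k t ^ (1 - 1 / q) ∂μ := by
      refine lintegral_congr_ae ?_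
      filter_upwards [hk0, hktop] with t h0 h1
      rw [ENNReal.mul_rpow_of_nonneg _ _ (by positivity), ← ENNReal.rpow_mul, ← ENNReal.rpow_mul,
        mul_one_div_cancel hq0.ne', ENNReal.rpow_one, mul_assoc, hpow t h0 h1]
      have : (1 - q) * (1 / q) + (1 - 1 / q) = 0 := by field_simp; ring
      rw [this, ENNReal.rpow_zero, mul_one]
    have h2 := ENNReal.lintegral_mul_norm_pow_le (μ := μ)
      (f := fun t => Φ t z ^ q * k t ^ (1 - q)) (g := k) (p := 1 / q) (q := 1 - 1 / q)
      (by fun_prop) hk.aemeasurable (by positivity)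
      (by rw [sub_nonneg, div_le_one hq0]; exact hq.le) (by ring)
    rw [← h1] at h2
    refine (ENNReal.rpow_le_rpow h2 hq0.le).trans_eq ?_
    rw [ENNReal.mul_rpow_of_nonneg _ _ hq0.le, ← ENNReal.rpow_mul, ← ENNReal.rpow_mul,
      one_div_mul_cancel hq0.ne', ENNReal.rpow_one]
    congr 2
    field_simp
  have hmeas : Measurable (Function.uncurry fun z t => Φ t z ^ q * k t ^ (1 - q)) := by
    have : Measurable fun x : β × α => Φ x.2 x.1 := hΦ.comp measurable_swap
    exact (this.pow_const q).mul ((hk.comp measurable_snd).pow_const _)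
  calc ∫⁻ z, (∫⁻ t, Φ t z ∂μ) ^ q ∂ν
      ≤ ∫⁻ z, (∫⁻ t, Φ t z ^ q * k t ^ (1 - q) ∂μ) * (∫⁻ t, k t ∂μ) ^ (q - 1) ∂ν :=
        lintegral_mono hstep
    _ = (∫⁻ t, ∫⁻ z, Φ t z ^ q * k t ^ (1 - q) ∂ν ∂μ) * (∫⁻ t, k t ∂μ) ^ (q - 1) := by
        rw [lintegral_mul_const', lintegral_lintegral_swap hmeas.aemeasurable]
        exact ENNReal.rpow_ne_top_of_nonneg (by linarith) hfin
    _ ≤ (∫⁻ t, k t ∂μ) * (∫⁻ t, k t ∂μ) ^ (q - 1) := by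
        refine mul_le_mul_left (lintegral_mono_ae ?_) _
        filter_upwards [hk0, hktop, hbound] with t h0 h1 h2
        have hΦt : Measurable fun z => Φ t z := hΦ.comp (measurable_const.prodMk measurable_id)
        rw [lintegral_mul_const _ (hΦt.pow_const q)]
        refine (mul_le_mul_left h2 _).trans_eq ?_
        rw [hpow t h0 h1, add_sub_cancel, ENNReal.rpow_one]
    _ = (∫⁻ t, k t ∂μ) ^ q := by
        conv_lhs => enter [1]; rw [← ENNReal.rpow_one (∫⁻ t, k t ∂μ)]
        rw [← ENNReal.rpow_add_of_nonneg _ _ zero_le_one (by linarith), add_sub_cancel]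

theorem isCompactOperator_smulRight {X Y : Type*} [NormedAddCommGroup X] [NormedSpace ℂ X]
    [NormedAddCommGroup Y] [NormedSpace ℂ Y] (a : X →L[ℂ] ℂ) (y : Y) :
    IsCompactOperator (a.smulRight y) :=
  ((isCompactOperator_id (E := ℂ)).comp_clm a).clm_comp (ContinuousLinearMap.toSpanSingleton ℂ y)

theorem isCompactOperator_sum {X Y ι : Type*} [NormedAddCommGroup X] [NormedSpace ℂ X]
    [NormedAddCommGroup Y] [NormedSpace ℂ Y] (s : Finset ι) {A : ι → X →L[ℂ] Y}
    (hA : ∀ i ∈ s, IsCompactOperator (A i)) : IsCompactOperator (∑ i ∈ s, A i : X →L[ℂ] Y) := by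
  classical
  induction s using Finset.induction_on with
  | empty => simpa using isCompactOperator_zero
  | insert i s hi ih =>
    rw [Finset.sum_insert hi]
    exact (hA i (Finset.mem_insert_self i s)).add
      (ih fun j hj => hA j (Finset.mem_insert_of_mem hj))

/-! ### The normalized area measure -/

theorem ofReal_pi_ne_zero : ENNReal.ofReal Real.pi ≠ 0 := by simp [Real.pi_pos]

theorem lintegral_discArea (g : ℂ → ℝ≥0∞) :
    ∫⁻ z, g z ∂discArea = (ENNReal.ofReal Real.pi)⁻¹ * ∫⁻ z in ball (0 : ℂ) 1, g z := by
  rw [discArea, lintegral_smul_measure, smul_eq_mul]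

instance isProbabilityMeasure_discArea : IsProbabilityMeasure discArea := by
  constructor
  rw [discArea, Measure.smul_apply, Measure.restrict_apply_univ, Complex.volume_ball]
  simp only [ENNReal.ofReal_one, one_pow, one_mul, smul_eq_mul]
  rw [show (NNReal.pi : ℝ≥0∞) = ENNReal.ofReal Real.pi from by
    rw [← NNReal.coe_real_pi, ENNReal.ofReal_coe_nnreal]]
  exact ENNReal.inv_mul_cancel ofReal_pi_ne_zero ENNReal.ofReal_ne_top

theorem ae_discArea_iff {P : ℂ → Prop} :
    (∀ᵐ z ∂discArea, P z) ↔ ∀ᵐ z ∂volume.restrict (ball (0 : ℂ) 1), P z := by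
  have hc : (ENNReal.ofReal Real.pi)⁻¹ ≠ 0 := by simp
  exact ⟨fun h => (Measure.absolutelyContinuous_smul hc).ae_le h,
    fun h => Measure.smul_absolutelyContinuous.ae_le h⟩

theorem ae_discArea_mem_ball : ∀ᵐ z ∂discArea, z ∈ ball (0 : ℂ) 1 :=
  ae_discArea_iff.2 (ae_restrict_mem measurableSet_ball)

theorem aestronglyMeasurable_discArea {F : ℂ → ℂ} (hF : ContinuousOn F (ball 0 1)) :
    AEStronglyMeasurable F discArea :=
  (hF.aestronglyMeasurable measurableSet_ball).mono_ac Measure.smul_absolutelyContinuous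

theorem eLpNorm_discArea_congr {F G : ℂ → ℂ} {p : ℝ≥0∞} (h : EqOn F G (ball 0 1)) :
    eLpNorm F p discArea = eLpNorm G p discArea := by
  refine eLpNorm_congr_ae ?_
  filter_upwards [ae_discArea_mem_ball] with z hz using h hz

/-! ### The Bergman space: evaluations, multipliers, Taylor coefficients, approximation of the
identity -/

section Bergman

variable {p : ℝ≥0∞} [Fact (1 ≤ p)]

theorem enorm_bergman (f : BergmanSpace p) : ‖f‖ₑ = eLpNorm (bergmanEval f) p discArea := by
  rw [← eLpNorm_congr_ae (ae_eq_bergmanEval f), ← Lp.enorm_def]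
  rfl

/-- The element of the Bergman space that is given by a holomorphic function of finite norm. -/
def bergmanOf (F : ℂ → ℂ) (hF : DifferentiableOn ℂ F (ball 0 1))
    (h : eLpNorm F p discArea < ∞) : BergmanSpace p :=
  ⟨MemLp.toLp F ⟨aestronglyMeasurable_discArea hF.continuousOn, h⟩, F, hF,
    MemLp.coeFn_toLp ⟨aestronglyMeasurable_discArea hF.continuousOn, h⟩⟩

theorem bergmanEval_bergmanOf {F : ℂ → ℂ} (hF : DifferentiableOn ℂ F (ball 0 1))
    (h : eLpNorm F p discArea < ∞) : EqOn (bergmanEval (bergmanOf F hF h)) F (ball 0 1) :=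
  bergmanEval_eq _ hF (MemLp.coeFn_toLp ⟨aestronglyMeasurable_discArea hF.continuousOn, h⟩)

theorem enorm_bergmanOf {F : ℂ → ℂ} (hF : DifferentiableOn ℂ F (ball 0 1))
    (h : eLpNorm F p discArea < ∞) : ‖bergmanOf F hF h‖ₑ = eLpNorm F p discArea := by
  rw [enorm_bergman, eLpNorm_discArea_congr (bergmanEval_bergmanOf hF h)]

theorem bergmanEval_add (f g : BergmanSpace p) :
    EqOn (bergmanEval (f + g)) (bergmanEval f + bergmanEval g) (ball 0 1) :=
  bergmanEval_eq _ ((differentiableOn_bergmanEval f).add (differentiableOn_bergmanEval g))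
    ((Lp.coeFn_add _ _).trans ((ae_eq_bergmanEval f).add (ae_eq_bergmanEval g)))

theorem bergmanEval_sub (f g : BergmanSpace p) :
    EqOn (bergmanEval (f - g)) (bergmanEval f - bergmanEval g) (ball 0 1) :=
  bergmanEval_eq _ ((differentiableOn_bergmanEval f).sub (differentiableOn_bergmanEval g))
    ((Lp.coeFn_sub _ _).trans ((ae_eq_bergmanEval f).sub (ae_eq_bergmanEval g)))

theorem bergmanEval_smul (c : ℂ) (f : BergmanSpace p) :
    EqOn (bergmanEval (c • f)) (c • bergmanEval f) (ball 0 1) :=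
  bergmanEval_eq _ ((differentiableOn_bergmanEval f).const_smul c)
    ((Lp.coeFn_smul _ _).trans ((ae_eq_bergmanEval f).const_smul c))

theorem bergman_ext {f g : BergmanSpace p} (h : EqOn (bergmanEval f) (bergmanEval g) (ball 0 1)) :
    f = g := by
  refine Subtype.ext (Lp.ext ?_)
  refine (ae_eq_bergmanEval f).trans (EventuallyEq.trans ?_ (ae_eq_bergmanEval g).symm)
  filter_upwards [ae_discArea_mem_ball] with z hz using h hz

theorem bergmanEval_sum {ι : Type*} (s : Finset ι) (f : ι → BergmanSpace p) {z : ℂ}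
    (hz : z ∈ ball (0 : ℂ) 1) :
    bergmanEval (∑ i ∈ s, f i) z = ∑ i ∈ s, bergmanEval (f i) z := by
  classical
  induction s using Finset.induction_on with
  | empty =>
    have := bergmanEval_smul (p := p) 0 0 hz
    simpa using this
  | insert i s hi ih =>
    rw [Finset.sum_insert hi, Finset.sum_insert hi, bergmanEval_add _ _ hz, Pi.add_apply, ih]

/-- Point evaluations in the disc are bounded on the Bergman space. -/
theorem norm_bergmanEval_le (f : BergmanSpace p) {w : ℂ} (hw : w ∈ ball (0 : ℂ) 1) :
    ‖bergmanEval f w‖ ≤ ‖f‖ / (1 - ‖w‖) ^ 2 := by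
  rw [mem_ball_zero_iff] at hw
  have hR : 0 < 1 - ‖w‖ := by linarith
  have hsub : ball w (1 - ‖w‖) ⊆ ball 0 1 := ball_subset_ball' (by simp)
  have h1 := enorm_le_lintegral_ball hR ((differentiableOn_bergmanEval f).mono hsub)
  have h2 : ∫⁻ z in ball (0 : ℂ) 1, ‖bergmanEval f z‖ₑ ≤ ENNReal.ofReal Real.pi * ‖f‖ₑ := by
    have h3 : ∫⁻ z, ‖bergmanEval f z‖ₑ ∂discArea ≤ ‖f‖ₑ := by
      rw [enorm_bergman, ← eLpNorm_one_eq_lintegral_enorm]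
      exact eLpNorm_le_eLpNorm_of_exponent_le Fact.out
        (aestronglyMeasurable_discArea (differentiableOn_bergmanEval f).continuousOn)
    rw [lintegral_discArea] at h3
    calc _ = ENNReal.ofReal Real.pi * ((ENNReal.ofReal Real.pi)⁻¹ *
          ∫⁻ z in ball (0 : ℂ) 1, ‖bergmanEval f z‖ₑ) := by
          rw [← mul_assoc, ENNReal.mul_inv_cancel ofReal_pi_ne_zero ENNReal.ofReal_ne_top, one_mul]
      _ ≤ _ := mul_le_mul_right h3 _
  have h4 := h1.trans ((lintegral_mono_set hsub).trans h2)
  rw [← ofReal_norm, ← ofReal_norm, ← ENNReal.ofReal_mul (by positivity),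
    ← ENNReal.ofReal_mul (by positivity), ENNReal.ofReal_le_ofReal_iff (by positivity), mul_assoc,
    mul_le_mul_iff_right₀ Real.pi_pos] at h4
  rw [le_div_iff₀ (by positivity)]
  linarith

/-- Multiplication by a bounded holomorphic function on the Bergman space. -/
theorem exists_mul_bergman {u : ℂ → ℂ} (hu : DifferentiableOn ℂ u (ball 0 1)) {c : ℝ}
    (hc : ∀ z ∈ ball (0 : ℂ) 1, ‖u z‖ ≤ c) :
    ∃ M : BergmanSpace p →L[ℂ] BergmanSpace p,
      ∀ f, EqOn (bergmanEval (M f)) (u * bergmanEval f) (ball 0 1) := by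
  have hc0 : 0 ≤ c := (norm_nonneg _).trans (hc 0 (by simp))
  have hbd : ∀ f : BergmanSpace p,
      eLpNorm (u * bergmanEval f) p discArea ≤ ENNReal.ofReal c * ‖f‖ₑ := by
    intro f
    rw [enorm_bergman]
    refine eLpNorm_le_mul_eLpNorm_of_ae_le_mul ?_ _
    filter_upwards [ae_discArea_mem_ball] with z hz
    rw [Pi.mul_apply, norm_mul]
    exact mul_le_mul_of_nonneg_right (hc z hz) (norm_nonneg _)
  have hfin : ∀ f : BergmanSpace p, eLpNorm (u * bergmanEval f) p discArea < ∞ := fun f =>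
    (hbd f).trans_lt (ENNReal.mul_lt_top ENNReal.ofReal_lt_top enorm_lt_top)
  have hd : ∀ f : BergmanSpace p, DifferentiableOn ℂ (u * bergmanEval f) (ball 0 1) := fun f =>
    hu.mul (differentiableOn_bergmanEval f)
  let A : BergmanSpace p →ₗ[ℂ] BergmanSpace p :=
    { toFun := fun f => bergmanOf (u * bergmanEval f) (hd f) (hfin f)
      map_add' := fun f g => bergman_ext fun z hz => by
        rw [bergmanEval_bergmanOf _ _ hz, bergmanEval_add _ _ hz, Pi.add_apply,
          bergmanEval_bergmanOf _ _ hz, bergmanEval_bergmanOf _ _ hz]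
        simp only [Pi.mul_apply, bergmanEval_add f g hz, Pi.add_apply]
        ring
      map_smul' := fun a f => bergman_ext fun z hz => by
        rw [bergmanEval_bergmanOf _ _ hz, RingHom.id_apply, bergmanEval_smul _ _ hz, Pi.smul_apply,
          bergmanEval_bergmanOf _ _ hz]
        simp only [Pi.mul_apply, bergmanEval_smul a f hz, Pi.smul_apply, smul_eq_mul]
        ring }
  refine ⟨A.mkContinuous c fun f => ?_, fun f => bergmanEval_bergmanOf (hd f) (hfin f)⟩
  have h := hbd f
  rw [← enorm_bergmanOf (hd f) (hfin f), ← ofReal_norm, ← ofReal_norm, ← ENNReal.ofReal_mul hc0,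
    ENNReal.ofReal_le_ofReal_iff (by positivity)] at h
  exact h

theorem norm_taylorCoeff_le (k : ℕ) (f : BergmanSpace p) {s : ℝ} (hs : 0 < s) (hs1 : s < 1) :
    ‖(k.factorial : ℂ)⁻¹ * iteratedDeriv k (bergmanEval f) 0‖ ≤ ‖f‖ / (1 - s) ^ 2 / s ^ k := by
  have h := Complex.norm_iteratedDeriv_le_of_forall_mem_sphere_norm_le (c := 0) (R := s)
    (C := ‖f‖ / (1 - s) ^ 2) (f := bergmanEval f) k hs
    ((differentiableOn_bergmanEval f).diffContOnCl_ball (closedBall_subset_ball hs1)) fun z hz => by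
      have h1 : ‖z‖ = s := by simpa using hz
      simpa [h1] using norm_bergmanEval_le f (w := z) (by simpa [h1] using hs1)
  rw [norm_mul, norm_inv, Complex.norm_natCast]
  have : (0 : ℝ) < k.factorial := by positivity
  rw [inv_mul_le_iff₀ this]
  rwa [← mul_div_assoc]

/-- The Taylor coefficients at `0` are bounded functionals. -/
theorem exists_taylorCoeff (k : ℕ) :
    ∃ a : BergmanSpace p →L[ℂ] ℂ,
      ∀ f, a f = (k.factorial : ℂ)⁻¹ * iteratedDeriv k (bergmanEval f) 0 := by
  have hnhds : ball (0 : ℂ) 1 ∈ 𝓝 0 := ball_mem_nhds _ one_pos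
  have hcd : ∀ f : BergmanSpace p, ContDiffAt ℂ k (bergmanEval f) 0 := fun f =>
    ((differentiableOn_bergmanEval f).contDiffOn isOpen_ball).contDiffAt hnhds
  let A : BergmanSpace p →ₗ[ℂ] ℂ :=
    { toFun := fun f => (k.factorial : ℂ)⁻¹ * iteratedDeriv k (bergmanEval f) 0
      map_add' := fun f g => by
        have h : bergmanEval (f + g) =ᶠ[𝓝 0] bergmanEval f + bergmanEval g := by
          filter_upwards [hnhds] with z hz using bergmanEval_add f g hz
        rw [h.iteratedDeriv_eq k, iteratedDeriv_add (hcd f) (hcd g), mul_add]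
      map_smul' := fun c f => by
        have h : bergmanEval (c • f) =ᶠ[𝓝 0] c • bergmanEval f := by
          filter_upwards [hnhds] with z hz using bergmanEval_smul c f hz
        rw [h.iteratedDeriv_eq k, iteratedDeriv_const_smul_field, RingHom.id_apply, smul_eq_mul,
          smul_eq_mul]
        ring }
  refine ⟨A.mkContinuous (1 / (1 - 1 / 2) ^ 2 / (1 / 2) ^ k) fun f => ?_, fun f => rfl⟩
  refine (norm_taylorCoeff_le k f (s := 1 / 2) (by norm_num) (by norm_num)).trans_eq ?_
  ring

theorem eLpNorm_rpow_toReal (hp_top : p ≠ ∞) {α : Type*} [MeasurableSpace α] (ν : Measure α)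
    (F : α → ℂ) : eLpNorm F p ν ^ p.toReal = ∫⁻ z, ‖F z‖ₑ ^ p.toReal ∂ν := by
  have hp0 : p ≠ 0 := (zero_lt_one.trans_le (Fact.out : 1 ≤ p)).ne'
  rw [eLpNorm_eq_lintegral_rpow_enorm_toReal hp0 hp_top, ← ENNReal.rpow_mul,
    one_div_mul_cancel (ENNReal.toReal_pos hp0 hp_top).ne', ENNReal.rpow_one]

theorem one_le_toReal (hp_top : p ≠ ∞) : 1 ≤ p.toReal := by
  simpa using ENNReal.toReal_mono hp_top (Fact.out : 1 ≤ p)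

/-- Dilations by `r ≥ 1 / 2` are bounded by `4` on the Bergman space. -/
theorem eLpNorm_dilation_le (hp_top : p ≠ ∞) (f : BergmanSpace p) {r : ℝ} (hr : 1 / 2 ≤ r)
    (hr1 : r < 1) : eLpNorm (fun z => bergmanEval f (r * z)) p discArea ≤ 4 * ‖f‖ₑ := by
  have hq := one_le_toReal hp_top
  have hr0 : 0 < r := by linarith
  have hrC : (r : ℂ) ≠ 0 := by exact_mod_cast hr0.ne'
  have hcov := setLIntegral_image_of_hasDerivAt (measurableSet_ball (x := (0:ℂ)) (ε := 1))
    (φ := fun z => r * z) (φ' := fun _ => r)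
    (fun z _ => by simpa using (hasDerivAt_id z).const_mul (r : ℂ))
    (fun x _ y _ hxy => mul_left_cancel₀ hrC hxy) (fun w => ‖bergmanEval f w‖ₑ ^ p.toReal)
  have hsub : (fun z => (r : ℂ) * z) '' ball 0 1 ⊆ ball 0 1 := by
    rintro _ ⟨z, hz, rfl⟩
    simp only [mem_ball_zero_iff, norm_mul, Complex.norm_real, Real.norm_eq_abs,
      abs_of_pos hr0] at *
    nlinarith [norm_nonneg z]
  rw [lintegral_const_mul' _ _ (by simp)] at hcov
  have h1 : (1 : ℝ≥0∞) ≤ 4 * ‖(r : ℂ)‖ₑ ^ 2 := by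
    rw [← ofReal_norm, Complex.norm_real, Real.norm_of_nonneg hr0.le,
      ← ENNReal.ofReal_pow hr0.le, show (4 : ℝ≥0∞) = ENNReal.ofReal 4 by simp,
      ← ENNReal.ofReal_mul (by norm_num), ENNReal.one_le_ofReal]
    nlinarith
  have h2 : ∫⁻ z in ball (0 : ℂ) 1, ‖bergmanEval f (r * z)‖ₑ ^ p.toReal ≤
      4 * ∫⁻ w in ball (0 : ℂ) 1, ‖bergmanEval f w‖ₑ ^ p.toReal := by
    calc _ ≤ (4 * ‖(r : ℂ)‖ₑ ^ 2) * ∫⁻ z in ball (0 : ℂ) 1, ‖bergmanEval f (r * z)‖ₑ ^ p.toReal :=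
          le_mul_of_one_le_left' h1
      _ ≤ _ := by
          rw [mul_assoc, ← hcov]
          exact mul_le_mul_right (lintegral_mono_set hsub) _
  rw [← ENNReal.rpow_le_rpow_iff (z := p.toReal) (by linarith),
    ENNReal.mul_rpow_of_nonneg _ _ (by linarith), enorm_bergman, eLpNorm_rpow_toReal hp_top,
    eLpNorm_rpow_toReal hp_top, lintegral_discArea, lintegral_discArea]
  calc _ ≤ (ENNReal.ofReal Real.pi)⁻¹ *
        (4 * ∫⁻ w in ball (0 : ℂ) 1, ‖bergmanEval f w‖ₑ ^ p.toReal) := mul_le_mul_right h2 _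
    _ = 4 * ((ENNReal.ofReal Real.pi)⁻¹ *
        ∫⁻ w in ball (0 : ℂ) 1, ‖bergmanEval f w‖ₑ ^ p.toReal) := by ring
    _ ≤ _ := by
        refine mul_le_mul_left ?_ _
        calc (4 : ℝ≥0∞) = 4 ^ (1 : ℝ) := by simp
          _ ≤ _ := ENNReal.rpow_le_rpow_of_exponent_le (by norm_num) hq

/-- Cauchy's estimate on circles of radius `(1 - ρ)/2` around points of the closed disc of radius
`ρ` bounds the derivative there, and the mean value inequality applies on the segment from `r w` to
`w`. -/
theorem norm_sub_dilation_le (f : BergmanSpace p) {r ρ : ℝ} (hr : 0 ≤ r) (hr1 : r ≤ 1)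
    (hρ : ρ < 1) {w : ℂ} (hw : ‖w‖ ≤ ρ) :
    ‖bergmanEval f w - bergmanEval f (r * w)‖ ≤ ‖f‖ / ((1 - ρ) / 2) ^ 3 * (1 - r) := by
  set d := (1 - ρ) / 2 with hd
  have hd0 : 0 < d := by rw [hd]; linarith
  have hderiv : ∀ z ∈ closedBall (0 : ℂ) ρ, ‖deriv (bergmanEval f) z‖ ≤ ‖f‖ / d ^ 3 := by
    intro z hz
    rw [mem_closedBall_zero_iff] at hz
    have hsub : closedBall z d ⊆ ball 0 1 := by
      intro u hu
      rw [mem_closedBall_iff_norm] at hu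
      rw [mem_ball_zero_iff]
      have := norm_le_norm_add_norm_sub' u z
      linarith
    have h := Complex.norm_deriv_le_of_forall_mem_sphere_norm_le (C := ‖f‖ / d ^ 2) hd0
      ((differentiableOn_bergmanEval f).diffContOnCl_ball hsub) fun u hu => by
        refine (norm_bergmanEval_le f (hsub (sphere_subset_closedBall hu))).trans ?_
        have hu' : ‖u - z‖ = d := by simpa [dist_eq_norm] using hu
        have := norm_le_norm_add_norm_sub' u z
        gcongr
        linarith
    refine h.trans_eq ?_
    field_simp
  have h := (convex_closedBall (0 : ℂ) ρ).norm_image_sub_le_of_norm_deriv_le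
    (f := bergmanEval f) (x := r * w) (y := w) (C := ‖f‖ / d ^ 3) (fun z hz =>
      (differentiableOn_bergmanEval f).differentiableAt (isOpen_ball.mem_nhds
        (closedBall_subset_ball hρ hz))) hderiv (by
        simp only [mem_closedBall_zero_iff, norm_mul, Complex.norm_real, Real.norm_of_nonneg hr]
        nlinarith [norm_nonneg w]) (by simpa using hw)
  refine h.trans (mul_le_mul_of_nonneg_left ?_ (by positivity))
  have : w - r * w = ((1 - r : ℝ) : ℂ) * w := by push_cast; ring
  rw [this, norm_mul, Complex.norm_real, Real.norm_of_nonneg (by linarith)]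
  nlinarith [norm_nonneg w]

/-- Finite rank operators that approximate the identity uniformly on compact subsets of the disc,
with uniformly bounded norms. -/
theorem exists_compact_approx_id (hp_top : p ≠ ∞) {ρ ε : ℝ} (hρ : ρ < 1) (hε : 0 < ε) :
    ∃ S : BergmanSpace p →L[ℂ] BergmanSpace p, IsCompactOperator S ∧ ∀ f,
      ‖f - S f‖ ≤ 6 * ‖f‖ ∧ bergmanEval (f - S f) 0 = 0 ∧
      ∀ w, ‖w‖ ≤ ρ → ‖bergmanEval (f - S f) w‖ ≤ ε * ‖f‖ := by
  obtain ⟨r, hr, hr1, hrε⟩ : ∃ r : ℝ, 1 / 2 ≤ r ∧ r < 1 ∧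
      1 / ((1 - ρ) / 2) ^ 3 * (1 - r) ≤ ε / 2 := by
    have hd0 : 0 < (1 - ρ) / 2 := by linarith
    set D := 1 / ((1 - ρ) / 2) ^ 3
    have hD : 0 < D := by positivity
    refine ⟨1 - min (1 / 2) (ε / 2 / D), by linarith [min_le_left (1 / 2) (ε / 2 / D)],
      by linarith [lt_min (show (0:ℝ) < 1 / 2 by norm_num) (show 0 < ε / 2 / D by positivity)], ?_⟩
    calc D * (1 - (1 - min (1 / 2) (ε / 2 / D))) = D * min (1 / 2) (ε / 2 / D) := by ring
      _ ≤ D * (ε / 2 / D) := mul_le_mul_of_nonneg_left (min_le_right _ _) hD.le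
      _ = ε / 2 := by field_simp
  have hr0 : 0 < r := by linarith
  -- Any radius strictly between `r` and `1` would do: Cauchy's estimate at radius `s` makes the
  -- Taylor series of the dilated function `f(rz)` geometric with ratio `r / s < 1`, uniformly on
  -- the whole disc.
  set s := (1 + r) / 2 with hs
  have hs0 : 0 < s := by rw [hs]; linarith
  have hs1 : s < 1 := by rw [hs]; linarith
  have hx1 : r / s < 1 := by rw [div_lt_one hs0, hs]; linarith
  have hx0 : 0 ≤ r / s := by positivity
  clear_value s
  have hε' : 0 < min (ε / 2) 1 := by positivity
  obtain ⟨n, hn⟩ : ∃ n : ℕ, 1 / (1 - s) ^ 2 * (r / s) ^ (n + 1) / (1 - r / s) ≤ min (ε / 2) 1 := by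
    have ht : Tendsto (fun n : ℕ => 1 / (1 - s) ^ 2 * (r / s) ^ (n + 1) / (1 - r / s)) atTop
        (𝓝 (1 / (1 - s) ^ 2 * 0 / (1 - r / s))) :=
      (((tendsto_pow_atTop_nhds_zero_of_lt_one hx0 hx1).comp (tendsto_add_atTop_nat 1)).const_mul
        _).div_const _
    simp only [mul_zero, zero_div] at ht
    exact (ht.eventually (Iic_mem_nhds hε')).exists
  choose a ha using exists_taylorCoeff (p := p)
  have hpow : ∀ k : ℕ, eLpNorm (fun z : ℂ => z ^ k) p discArea < ∞ := by
    intro k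
    refine (eLpNorm_le_of_ae_bound (C := 1) ?_).trans_lt (by simp)
    filter_upwards [ae_discArea_mem_ball] with z hz
    rw [norm_pow]
    exact pow_le_one₀ (norm_nonneg _) (by simpa using (mem_ball_zero_iff.1 hz).le)
  have hpd : ∀ k : ℕ, DifferentiableOn ℂ (fun z : ℂ => z ^ k) (ball 0 1) := fun k => by fun_prop
  set e : ℕ → BergmanSpace p := fun k => bergmanOf (fun z => z ^ k) (hpd k) (hpow k) with he
  -- The Taylor polynomial of degree `n` of the dilation `z ↦ f(rz)`.
  set S : BergmanSpace p →L[ℂ] BergmanSpace p :=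
    ∑ k ∈ Finset.range (n + 1), ((r : ℂ) ^ k • a k).smulRight (e k) with hS
  have hScomp : IsCompactOperator S :=
    isCompactOperator_sum _ fun k _ => isCompactOperator_smulRight _ _
  have hSf : ∀ f, ∀ z ∈ ball (0 : ℂ) 1, bergmanEval (S f) z =
      ∑ k ∈ Finset.range (n + 1), a k f * (r * z) ^ k := by
    intro f z hz
    rw [hS, sum_apply, bergmanEval_sum _ _ hz]
    refine Finset.sum_congr rfl fun k _ => ?_
    rw [ContinuousLinearMap.smulRight_apply, bergmanEval_smul _ _ hz, Pi.smul_apply, he,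
      bergmanEval_bergmanOf _ _ hz, smul_apply, smul_eq_mul, smul_eq_mul,
      mul_pow]
    ring
  have hrz : ∀ z ∈ ball (0 : ℂ) 1, (r : ℂ) * z ∈ ball (0 : ℂ) 1 := by
    intro z hz
    rw [mem_ball_zero_iff] at *
    rw [norm_mul, Complex.norm_real, Real.norm_of_nonneg hr0.le]
    nlinarith [norm_nonneg z]
  have htail : ∀ f, ∀ z ∈ ball (0 : ℂ) 1,
      ‖bergmanEval f (r * z) - bergmanEval (S f) z‖ ≤ min (ε / 2) 1 * ‖f‖ := by
    intro f z hz
    have hsum := Complex.hasSum_taylorSeries_on_ball (differentiableOn_bergmanEval f) (hrz z hz)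
    have hz1 := mem_ball_zero_iff.1 hz
    have h := norm_sub_le_of_geometric_bound_of_hasSum (r := r / s) (C := ‖f‖ / (1 - s) ^ 2) hx1
      (fun k => ?_) hsum (n + 1)
    · rw [hSf f z hz, norm_sub_rev]
      calc _ ≤ ‖f‖ / (1 - s) ^ 2 * (r / s) ^ (n + 1) / (1 - r / s) := by
            refine le_trans (le_of_eq ?_) h
            congr 2
            refine Finset.sum_congr rfl fun k _ => ?_
            rw [ha, sub_zero, smul_eq_mul, smul_eq_mul]
            ring
        _ = 1 / (1 - s) ^ 2 * (r / s) ^ (n + 1) / (1 - r / s) * ‖f‖ := by ring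
        _ ≤ _ := mul_le_mul_of_nonneg_right hn (norm_nonneg _)
    · have h1 := norm_taylorCoeff_le k f hs0 hs1
      rw [sub_zero, smul_eq_mul, smul_eq_mul, mul_left_comm, norm_mul, norm_pow, norm_mul,
        Complex.norm_real, Real.norm_of_nonneg hr0.le]
      calc (r * ‖z‖) ^ k * _ ≤ r ^ k * (‖f‖ / (1 - s) ^ 2 / s ^ k) := by
            refine mul_le_mul (pow_le_pow_left₀ (by positivity) ?_ _) h1 (norm_nonneg _)
              (by positivity)
            nlinarith [norm_nonneg z]
        _ = _ := by rw [div_pow]; ring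
  refine ⟨S, hScomp, fun f => ⟨?_, ?_, ?_⟩⟩
  · have h1 := eLpNorm_dilation_le hp_top f hr hr1
    have hm1 : AEStronglyMeasurable (bergmanEval f) discArea :=
      aestronglyMeasurable_discArea (differentiableOn_bergmanEval f).continuousOn
    have hm2 : AEStronglyMeasurable (fun z => bergmanEval f (r * z)) discArea :=
      aestronglyMeasurable_discArea ((differentiableOn_bergmanEval f).continuousOn.comp
        (by fun_prop) hrz)
    have hm3 : AEStronglyMeasurable (bergmanEval (S f)) discArea :=
      aestronglyMeasurable_discArea (differentiableOn_bergmanEval _).continuousOn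
    have h2 : eLpNorm ((fun z => bergmanEval f (r * z)) - bergmanEval (S f)) p discArea ≤ ‖f‖ₑ := by
      refine (eLpNorm_le_of_ae_bound (C := ‖f‖) ?_).trans (by simp; exact le_rfl)
      filter_upwards [ae_discArea_mem_ball] with z hz
      refine (htail f z hz).trans ?_
      nlinarith [norm_nonneg f, min_le_right (ε / 2) 1]
    -- `6 = 1 + 4 + 1`: the function, its dilation, and the Taylor tail of the dilation.
    have h3 : ‖f - S f‖ₑ ≤ 6 * ‖f‖ₑ := by
      rw [enorm_bergman (f - S f), eLpNorm_discArea_congr (bergmanEval_sub f (S f))]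
      have e1 : bergmanEval f - bergmanEval (S f) =
          (bergmanEval f - fun z => bergmanEval f (r * z)) +
          ((fun z => bergmanEval f (r * z)) - bergmanEval (S f)) := by abel
      rw [e1]
      refine (eLpNorm_add_le (hm1.sub hm2) (hm2.sub hm3) Fact.out).trans ?_
      refine (add_le_add ((eLpNorm_sub_le hm1 hm2 Fact.out).trans (add_le_add_right h1 _))
        h2).trans_eq ?_
      rw [← enorm_bergman]
      ring
    rw [← ofReal_norm, ← ofReal_norm, show (6 : ℝ≥0∞) = ENNReal.ofReal 6 by simp,
      ← ENNReal.ofReal_mul (by norm_num), ENNReal.ofReal_le_ofReal_iff (by positivity)] at h3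
    exact h3
  · have h0 : (0 : ℂ) ∈ ball (0 : ℂ) 1 := by simp
    rw [bergmanEval_sub _ _ h0, Pi.sub_apply, hSf f 0 h0, Finset.sum_range_succ',
      Finset.sum_eq_zero (fun k _ => by simp), ha]
    simp
  · intro w hw
    have hw1 : w ∈ ball (0 : ℂ) 1 := by rw [mem_ball_zero_iff]; linarith
    rw [bergmanEval_sub _ _ hw1, Pi.sub_apply]
    have h1 := norm_sub_dilation_le f hr0.le hr1.le hρ hw
    have h2 : ‖f‖ / ((1 - ρ) / 2) ^ 3 * (1 - r) ≤ ε / 2 * ‖f‖ := by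
      calc _ = (1 / ((1 - ρ) / 2) ^ 3 * (1 - r)) * ‖f‖ := by ring
        _ ≤ _ := mul_le_mul_of_nonneg_right hrε (norm_nonneg _)
    have h3 := htail f w hw1
    have h4 := norm_sub_le_norm_sub_add_norm_sub (bergmanEval f w) (bergmanEval f (r * w))
      (bergmanEval (S f) w)
    nlinarith [norm_nonneg f, min_le_left (ε / 2) 1]

end Bergman

/-! ### The weight and the geometry of the symbols -/

/-- The essential norm of the weighted composition operator `T_t` on `A^q`. -/
def gammaWeight (q t : ℝ) : ℝ≥0∞ :=
  ENNReal.ofReal t ^ (2 / q - 1) / ENNReal.ofReal (1 - t) ^ (2 / q)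

theorem measurable_gammaWeight (q : ℝ) : Measurable (gammaWeight q) := by
  unfold gammaWeight
  fun_prop

theorem gammaWeight_of_mem_Ioo {q t : ℝ} (ht : t ∈ Ioo (0 : ℝ) 1) :
    gammaWeight q t = ENNReal.ofReal (t ^ (2 / q - 1) / (1 - t) ^ (2 / q)) := by
  have h1 : 0 < 1 - t := by linarith [ht.2]
  rw [gammaWeight, ENNReal.ofReal_rpow_of_pos ht.1, ENNReal.ofReal_rpow_of_pos h1,
    ENNReal.ofReal_div_of_pos (Real.rpow_pos_of_pos h1 _)]

theorem gammaWeight_rpow {q t : ℝ} (hq : 0 < q) (ht : t ∈ Ioo (0 : ℝ) 1) :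
    gammaWeight q t ^ q = ENNReal.ofReal (t ^ (2 - q) / (1 - t) ^ 2) := by
  have h1 : 0 < 1 - t := by linarith [ht.2]
  have h0 := ht.1
  rw [gammaWeight_of_mem_Ioo ht, ENNReal.ofReal_rpow_of_nonneg (by positivity) hq.le,
    Real.div_rpow (by positivity) (by positivity), ← Real.rpow_mul h0.le, ← Real.rpow_mul h1.le,
    div_mul_cancel₀ _ hq.ne', sub_mul, div_mul_cancel₀ _ hq.ne', one_mul, Real.rpow_two]

/-- In this form the real part visibly exceeds `t` for `z` in the disc and `t < 1`. This keeps the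
denominator in the right half-plane, makes the symbols self-maps of the disc and makes the branches
of the powers below compatible. -/
theorem re_denom (t : ℝ) (z : ℂ) : (1 + ((t : ℂ) - 1) * z).re = t + (1 - t) * (1 - z.re) := by
  simp; ring

theorem re_lt_one {z : ℂ} (hz : z ∈ ball (0 : ℂ) 1) : z.re < 1 :=
  (Complex.re_le_norm z).trans_lt (mem_ball_zero_iff.1 hz)

theorem re_denom_pos {t : ℝ} (ht : t ∈ Ico (0 : ℝ) 1) {z : ℂ} (hz : z ∈ ball (0 : ℂ) 1) :
    0 < (1 + ((t : ℂ) - 1) * z).re := by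
  rw [re_denom]
  have := re_lt_one hz
  nlinarith [ht.1, ht.2, mul_pos (sub_pos.2 ht.2) (sub_pos.2 this)]

theorem denom_ne_zero {t : ℝ} (ht : t ∈ Ico (0 : ℝ) 1) {z : ℂ} (hz : z ∈ ball (0 : ℂ) 1) :
    1 + ((t : ℂ) - 1) * z ≠ 0 := fun h => by
  have := re_denom_pos ht hz
  rw [h] at this
  simp at this

theorem lt_norm_denom {t : ℝ} (ht : t ∈ Ico (0 : ℝ) 1) {z : ℂ} (hz : z ∈ ball (0 : ℂ) 1) :
    t < ‖1 + ((t : ℂ) - 1) * z‖ := by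
  refine lt_of_lt_of_le ?_ (Complex.re_le_norm _)
  rw [re_denom]
  have := mul_pos (sub_pos.2 ht.2) (sub_pos.2 (re_lt_one hz))
  linarith

theorem mapsTo_ball_moebius {t : ℝ} (ht : t ∈ Ico (0 : ℝ) 1) :
    MapsTo (fun z : ℂ => (t : ℂ) / (1 + ((t : ℂ) - 1) * z)) (ball 0 1) (ball 0 1) := by
  intro z hz
  have h := lt_norm_denom ht hz
  rw [mem_ball_zero_iff, norm_div, Complex.norm_real, Real.norm_of_nonneg ht.1,
    div_lt_one (ht.1.trans_lt h)]
  exact h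

theorem weightedComp_congr {t : ℝ} (ht : t ∈ Ico (0 : ℝ) 1) {F G : ℂ → ℂ}
    (h : EqOn F G (ball 0 1)) : EqOn (weightedComp t F) (weightedComp t G) (ball 0 1) := by
  intro z hz
  simp only [weightedComp, h (mapsTo_ball_moebius ht hz)]

theorem continuousOn_weightedComp {t : ℝ} (ht : t ∈ Ico (0 : ℝ) 1) {F : ℂ → ℂ}
    (hF : ContinuousOn F (ball 0 1)) : ContinuousOn (weightedComp t F) (ball 0 1) := by
  have hd : ContinuousOn (fun z : ℂ => 1 + ((t : ℂ) - 1) * z) (ball 0 1) := by fun_prop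
  have hne : ∀ z ∈ ball (0 : ℂ) 1, 1 + ((t : ℂ) - 1) * z ≠ 0 := fun z hz => denom_ne_zero ht hz
  exact (continuousOn_const.div hd hne).mul
    (hF.comp (continuousOn_const.div hd hne) (mapsTo_ball_moebius ht))

/-- The punctured disc with diameter `(0, 1)`, which contains all the images of the unit disc under
the maps `z ↦ t / (1 + (t - 1) z)`. -/
def innerDisc : Set ℂ := {w | w ≠ 0 ∧ ‖w‖ < 1 ∧ ‖w‖ ^ 2 ≤ w.re}

theorem measurableSet_innerDisc : MeasurableSet innerDisc := by
  unfold innerDisc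
  measurability

/-- For `w = t / v` with `t ≤ Re v` one gets `|w|^2 = t^2/|v|^2 ≤ t Re v/|v|^2 = Re w`. -/
theorem image_moebius_subset {t : ℝ} (ht : t ∈ Ioo (0 : ℝ) 1) :
    (fun z : ℂ => (t : ℂ) / (1 + ((t : ℂ) - 1) * z)) '' ball 0 1 ⊆ innerDisc := by
  have ht' : t ∈ Ico (0 : ℝ) 1 := ⟨ht.1.le, ht.2⟩
  rintro _ ⟨z, hz, rfl⟩
  have hne := denom_ne_zero ht' hz
  refine ⟨div_ne_zero (by exact_mod_cast ht.1.ne') hne,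
    mem_ball_zero_iff.1 (mapsTo_ball_moebius ht' hz), ?_⟩
  have hre : t ≤ (1 + ((t : ℂ) - 1) * z).re := by
    rw [re_denom]
    have := mul_pos (sub_pos.2 ht.2) (sub_pos.2 (re_lt_one hz))
    linarith
  set v := 1 + ((t : ℂ) - 1) * z
  have hv : 0 < Complex.normSq v := Complex.normSq_pos.2 hne
  simp only
  rw [← Complex.normSq_eq_norm_sq, Complex.normSq_div, Complex.normSq_ofReal, Complex.div_re]
  simp only [Complex.ofReal_re, Complex.ofReal_im, zero_mul, zero_div, add_zero]
  gcongr
  exact ht.1.le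

/-! ### Norm estimates for the weighted composition operators -/

section

variable {p : ℝ≥0∞} [Fact (1 ≤ p)]

/-- Substitute `w = t/v`. Since `|φ_t'| = t(1-t)/|v|^2` and `|v| = t/|w|`, one has `|v|^(-q) =
gammaWeight q t ^ q * |φ_t'|^2 * |w|^(q-4)`. The only loss is the enlargement of the image of the
disc to `innerDisc`, which does not depend on `t`. -/
theorem eLpNorm_weightedComp_rpow_le (hp_top : p ≠ ∞) {t : ℝ} (ht : t ∈ Ioo (0 : ℝ) 1) (F : ℂ → ℂ) :
    eLpNorm (weightedComp t F) p discArea ^ p.toReal ≤ gammaWeight p.toReal t ^ p.toReal *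
      ∫⁻ w in innerDisc, ENNReal.ofReal (‖w‖ ^ (p.toReal - 4)) * ‖F w‖ₑ ^ p.toReal ∂discArea := by
  have hq : 0 < p.toReal := zero_lt_one.trans_le (one_le_toReal hp_top)
  set q := p.toReal with hqdef
  have ht' : t ∈ Ico (0 : ℝ) 1 := ⟨ht.1.le, ht.2⟩
  have h1t : 0 < 1 - t := by linarith [ht.2]
  have htC : (t : ℂ) ≠ 0 := by exact_mod_cast ht.1.ne'
  have ht1C : (t : ℂ) - 1 ≠ 0 := by
    have : t - 1 ≠ 0 := by linarith
    exact_mod_cast this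
  set g : ℂ → ℝ≥0∞ := fun w => ENNReal.ofReal (‖w‖ ^ (q - 4)) * ‖F w‖ₑ ^ q with hg
  have hcov := setLIntegral_image_of_hasDerivAt (measurableSet_ball (x := (0:ℂ)) (ε := 1))
    (φ := fun z => (t : ℂ) / (1 + ((t : ℂ) - 1) * z))
    (φ' := fun z => t * (1 - t) / (1 + ((t : ℂ) - 1) * z) ^ 2)
    (fun z hz => by
      have h1 : HasDerivAt (fun z : ℂ => 1 + ((t : ℂ) - 1) * z) ((t : ℂ) - 1) z := by
        simpa using ((hasDerivAt_id z).const_mul ((t : ℂ) - 1)).const_add 1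
      have h2 := (hasDerivAt_const z (t : ℂ)).div h1 (denom_ne_zero ht' hz)
      convert! h2 using 1
      ring)
    (fun x hx y hy hxy => by
      have hx' := denom_ne_zero ht' hx
      have hy' := denom_ne_zero ht' hy
      simp only at hxy
      rw [div_eq_div_iff hx' hy'] at hxy
      have h2 := mul_left_cancel₀ htC hxy
      exact mul_left_cancel₀ ht1C (by linear_combination -h2)) g
  have hpt : ∀ z ∈ ball (0 : ℂ) 1, ‖weightedComp t F z‖ₑ ^ q = gammaWeight q t ^ q *
      (‖(t * (1 - t) / (1 + ((t : ℂ) - 1) * z) ^ 2 : ℂ)‖ₑ ^ 2 *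
        g ((t : ℂ) / (1 + ((t : ℂ) - 1) * z))) := by
    intro z hz
    have hne := denom_ne_zero ht' hz
    set v := 1 + ((t : ℂ) - 1) * z with hv
    have hv0 : 0 < ‖v‖ := norm_pos_iff.2 hne
    have ht0 := ht.1
    simp only [weightedComp, ← hv, hg]
    rw [enorm_mul, ENNReal.mul_rpow_of_nonneg _ _ hq.le, ← mul_assoc, ← mul_assoc]
    congr 1
    rw [gammaWeight_rpow hq ht, ← ofReal_norm, ← ofReal_norm,
      ENNReal.ofReal_rpow_of_nonneg (norm_nonneg _) hq.le, ← ENNReal.ofReal_pow (norm_nonneg _),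
      ← ENNReal.ofReal_mul (by positivity), ← ENNReal.ofReal_mul (by positivity)]
    congr 1
    have e1 : ‖(1 - (t : ℂ))‖ = 1 - t := by
      rw [← Complex.ofReal_one, ← Complex.ofReal_sub, Complex.norm_real,
        Real.norm_of_nonneg h1t.le]
    rw [norm_div, norm_div, norm_div, norm_mul, norm_pow, e1, Complex.norm_real,
      Real.norm_of_nonneg ht0.le, norm_one, Real.div_rpow zero_le_one hv0.le,
      Real.div_rpow ht0.le hv0.le, Real.one_rpow, Real.rpow_sub ht0, Real.rpow_sub ht0,
      Real.rpow_sub hv0, Real.rpow_two]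
    have : t ^ (4 : ℝ) = t ^ 4 := by exact_mod_cast Real.rpow_natCast t 4
    rw [this]
    have : ‖v‖ ^ (4 : ℝ) = ‖v‖ ^ 4 := by exact_mod_cast Real.rpow_natCast ‖v‖ 4
    rw [this]
    have a1 : 0 < t ^ q := Real.rpow_pos_of_pos ht0 q
    have a2 : 0 < ‖v‖ ^ q := Real.rpow_pos_of_pos hv0 q
    field_simp
  have hfin : gammaWeight q t ^ q ≠ ∞ := by
    rw [gammaWeight_rpow hq ht]; exact ENNReal.ofReal_ne_top
  have hsub := image_moebius_subset ht
  have hsub2 : innerDisc ⊆ ball 0 1 := fun w hw => mem_ball_zero_iff.2 hw.2.1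
  rw [eLpNorm_rpow_toReal hp_top, lintegral_discArea, setLIntegral_congr_fun measurableSet_ball hpt,
    lintegral_const_mul' _ _ hfin, ← hcov, ← lintegral_indicator measurableSet_innerDisc,
    lintegral_discArea, mul_left_comm]
  refine mul_le_mul_right (mul_le_mul_right ?_ _) _
  rw [lintegral_indicator measurableSet_innerDisc, Measure.restrict_restrict measurableSet_innerDisc,
    inter_eq_left.2 hsub2]
  exact lintegral_mono_set hsub

/-- The factor `w^4` turns the weight `|w|^(q-4)` into `|w|^(5q-4)`, which is at most `1`, so the
constant in front of the norm is exactly the weight. -/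
theorem eLpNorm_weightedComp_pow_four_mul_le (hp_top : p ≠ ∞) {t : ℝ} (ht : t ∈ Ioo (0 : ℝ) 1)
    (f : BergmanSpace p) :
    eLpNorm (weightedComp t fun w => w ^ 4 * bergmanEval f w) p discArea ≤
      gammaWeight p.toReal t * ‖f‖ₑ := by
  have hq1 := one_le_toReal hp_top
  have hq : 0 < p.toReal := by linarith
  rw [← ENNReal.rpow_le_rpow_iff hq, ENNReal.mul_rpow_of_nonneg _ _ hq.le]
  refine (eLpNorm_weightedComp_rpow_le hp_top ht _).trans (mul_le_mul_right ?_ _)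
  rw [enorm_bergman, eLpNorm_rpow_toReal hp_top]
  refine le_trans (setLIntegral_mono' measurableSet_innerDisc fun w hw => ?_)
    (setLIntegral_le_lintegral innerDisc _)
  have hw0 : 0 < ‖w‖ := norm_pos_iff.2 hw.1
  rw [enorm_mul, ENNReal.mul_rpow_of_nonneg _ _ hq.le, ← mul_assoc]
  refine mul_le_of_le_one_left' ?_
  rw [← ofReal_norm, ENNReal.ofReal_rpow_of_nonneg (norm_nonneg _) hq.le, norm_pow,
    ← ENNReal.ofReal_mul (by positivity), ENNReal.ofReal_le_one, ← Real.rpow_natCast_mul hw0.le,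
    ← Real.rpow_add hw0]
  exact Real.rpow_le_one hw0.le hw.2.1.le (by push_cast; linarith)

/-- Three regions of `innerDisc` are treated separately. For `|w| < 1/2`, Schwarz's lemma improves
the weight to `|w|^(2q-4)`, integrable because `q > 1`. For `|1 - w| ≤ η` the factor `1 - w^4` is
small. The rest lies in a compact part of the disc, where `g` is small. -/
theorem exists_eLpNorm_weightedComp_one_sub_pow_four_mul_le (hp : 1 < p) (hp_top : p ≠ ∞) {b : ℝ}
    (hb : 0 < b) : ∃ ρ < 1, ∃ ε > 0, ∀ (g : BergmanSpace p) (N : ℝ), 0 ≤ N → ‖g‖ ≤ 6 * N →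
      bergmanEval g 0 = 0 → (∀ w, ‖w‖ ≤ ρ → ‖bergmanEval g w‖ ≤ ε * N) →
      ∀ t ∈ Ioo (0 : ℝ) 1,
      eLpNorm (weightedComp t fun w => (1 - w ^ 4) * bergmanEval g w) p discArea ≤
        gammaWeight p.toReal t * ENNReal.ofReal (b * N) := by
  have hq1 : 1 < p.toReal := by
    simpa using (ENNReal.toReal_lt_toReal ENNReal.one_ne_top hp_top).2 hp
  have hq : 0 < p.toReal := by linarith
  set q := p.toReal with hqdef
  set I : ℝ≥0∞ := ∫⁻ w, ENNReal.ofReal (‖w‖ ^ (2 * q - 4)) ∂discArea with hI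
  have hIfin : I ≠ ∞ := by
    rw [hI, lintegral_discArea]
    exact ENNReal.mul_ne_top (by simp [Real.pi_pos])
      (lintegral_ball_norm_rpow_lt_top (by linarith) 1).ne
  have hchoose : ∀ A B : ℝ, 0 ≤ A → 0 < B → ∃ x : ℝ, 0 < x ∧ A * x ^ q ≤ B := by
    intro A B hA hB
    refine ⟨(B / (A + 1)) ^ (1 / q), by positivity, ?_⟩
    rw [← Real.rpow_mul (by positivity), one_div_mul_cancel hq.ne', Real.rpow_one,
      mul_div_assoc', div_le_iff₀ (by positivity)]
    nlinarith
  -- `16` bounds `|w|^(q-4)` for `|w| ≥ 1/2`; `24 = 4 * 6` combines `|1 - w^4| ≤ 4η` with `‖g‖ ≤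
  -- 6N`. The `η` and `ε` terms each receive half of `b^q`.
  obtain ⟨η, hη, hηb⟩ := hchoose (16 * 24 ^ q) (b ^ q / 2) (by positivity) (by positivity)
  obtain ⟨ε, hε, hεb⟩ := hchoose (4 ^ q * I.toReal + 16 * 2 ^ q) (b ^ q / 2) (by positivity)
    (by positivity)
  -- On `innerDisc`, `|1 - w|^2 = 1 - 2 Re w + |w|^2 ≤ 1 - |w|^2`, so `|1 - w| > η` forces `|w| <
  -- √(1 - η^2)`. The radius `1/2` serves Schwarz's lemma.
  refine ⟨max (1 / 2) √(1 - η ^ 2), max_lt (by norm_num) ?_, ε, hε, ?_⟩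
  · rw [Real.sqrt_lt' one_pos]
    nlinarith
  intro g N hN hgN hg0 hgε t ht
  have hdg := differentiableOn_bergmanEval g
  have hpt : ∀ w ∈ innerDisc, ENNReal.ofReal (‖w‖ ^ (q - 4)) *
      ‖(1 - w ^ 4) * bergmanEval g w‖ₑ ^ q ≤
      ENNReal.ofReal ((4 * ε * N) ^ q) * ENNReal.ofReal (‖w‖ ^ (2 * q - 4)) +
      ENNReal.ofReal (16 * (4 * η) ^ q) * ‖bergmanEval g w‖ₑ ^ q +
      ENNReal.ofReal (16 * (2 * ε * N) ^ q) := by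
    rintro w ⟨hw, hw1, hwre⟩
    have hw0 : 0 < ‖w‖ := norm_pos_iff.2 hw
    rw [← ofReal_norm, ← ofReal_norm, ENNReal.ofReal_rpow_of_nonneg (norm_nonneg _) hq.le,
      ENNReal.ofReal_rpow_of_nonneg (norm_nonneg _) hq.le, ← ENNReal.ofReal_mul (by positivity),
      ← ENNReal.ofReal_mul (by positivity), ← ENNReal.ofReal_mul (by positivity),
      ← ENNReal.ofReal_add (by positivity) (by positivity),
      ← ENNReal.ofReal_add (by positivity) (by positivity)]
    refine ENNReal.ofReal_le_ofReal ?_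
    rw [norm_mul]
    have h2 : ‖1 - w ^ 4‖ ≤ 2 := by
      refine (norm_sub_le _ _).trans ?_
      rw [norm_one, norm_pow]
      linarith [pow_le_one₀ (n := 4) hw0.le hw1.le]
    have p1 : 0 ≤ (4 * ε * N) ^ q * ‖w‖ ^ (2 * q - 4) := by positivity
    have p2 : 0 ≤ 16 * (4 * η) ^ q * ‖bergmanEval g w‖ ^ q := by positivity
    have p3 : 0 ≤ 16 * (2 * ε * N) ^ q := by positivity
    rcases lt_or_ge ‖w‖ (1 / 2) with hsmall | hlarge
    · have hG : ‖bergmanEval g w‖ ≤ 2 * ε * N * ‖w‖ := by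
        have := Complex.dist_le_div_mul_dist_of_mapsTo_ball (f := bergmanEval g) (c := 0) (z := w)
          (R₁ := 1 / 2) (R₂ := ε * N) (hdg.mono (ball_subset_ball (by norm_num))) (fun u hu => by
            rw [hg0, mem_closedBall_zero_iff]
            exact hgε u (le_max_of_le_left (mem_ball_zero_iff.1 hu).le))
          (by simpa using hsmall)
        rw [hg0, dist_zero_right, dist_zero_right] at this
        linarith
      calc ‖w‖ ^ (q - 4) * (‖1 - w ^ 4‖ * ‖bergmanEval g w‖) ^ q
          ≤ ‖w‖ ^ (q - 4) * (4 * ε * N * ‖w‖) ^ q := by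
            refine mul_le_mul_of_nonneg_left (Real.rpow_le_rpow (by positivity) ?_ hq.le)
              (by positivity)
            calc _ ≤ 2 * (2 * ε * N * ‖w‖) := mul_le_mul h2 hG (norm_nonneg _) (by norm_num)
              _ = _ := by ring
        _ = (4 * ε * N) ^ q * ‖w‖ ^ (2 * q - 4) := by
            rw [Real.mul_rpow (by positivity) hw0.le, mul_left_comm, ← Real.rpow_add hw0]
            congr 2
            ring
        _ ≤ _ := by linarith
    · have h16 : ‖w‖ ^ (q - 4) ≤ 16 := by
        calc ‖w‖ ^ (q - 4) ≤ ‖w‖ ^ (-4 : ℝ) :=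
              Real.rpow_le_rpow_of_exponent_ge hw0 hw1.le (by linarith)
          _ ≤ (1 / 2) ^ (-4 : ℝ) :=
              Real.rpow_le_rpow_of_nonpos (by norm_num) hlarge (by norm_num)
          _ = 16 := by
              rw [show (-4 : ℝ) = ((-4 : ℤ) : ℝ) by norm_num, Real.rpow_intCast]; norm_num
      rcases le_or_gt ‖1 - w‖ η with hnear | hfar
      · have h4 : ‖1 - w ^ 4‖ ≤ 4 * η := by
          have : 1 - w ^ 4 = (1 - w) * (1 + w + w ^ 2 + w ^ 3) := by ring
          rw [this, norm_mul, mul_comm]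
          refine mul_le_mul ?_ hnear (norm_nonneg _) (by norm_num)
          have a1 := norm_add_le (1 + w + w ^ 2) (w ^ 3)
          have a2 := norm_add_le (1 + w) (w ^ 2)
          have a3 := norm_add_le 1 w
          rw [norm_pow] at a1 a2
          rw [norm_one] at a3
          have b1 := pow_le_one₀ (n := 2) hw0.le hw1.le
          have b2 := pow_le_one₀ (n := 3) hw0.le hw1.le
          linarith
        calc ‖w‖ ^ (q - 4) * (‖1 - w ^ 4‖ * ‖bergmanEval g w‖) ^ q
            ≤ 16 * (4 * η * ‖bergmanEval g w‖) ^ q := by gcongr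
          _ = 16 * (4 * η) ^ q * ‖bergmanEval g w‖ ^ q := by
              rw [Real.mul_rpow (by positivity) (norm_nonneg _), mul_assoc]
          _ ≤ _ := by linarith
      · have hρ : ‖w‖ ≤ √(1 - η ^ 2) := by
          refine Real.le_sqrt_of_sq_le ?_
          have : ‖1 - w‖ ^ 2 = 1 - 2 * w.re + ‖w‖ ^ 2 := by
            rw [← Complex.normSq_eq_norm_sq, ← Complex.normSq_eq_norm_sq, Complex.normSq_apply,
              Complex.normSq_apply]
            simp
            ring
          nlinarith [pow_lt_pow_left₀ hfar hη.le two_ne_zero]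
        have hG := hgε w (hρ.trans (le_max_right _ _))
        calc ‖w‖ ^ (q - 4) * (‖1 - w ^ 4‖ * ‖bergmanEval g w‖) ^ q
            ≤ 16 * (2 * ε * N) ^ q := by
              refine mul_le_mul h16 (Real.rpow_le_rpow (by positivity) ?_ hq.le) (by positivity)
                (by norm_num)
              calc _ ≤ 2 * (ε * N) := mul_le_mul h2 hG (norm_nonneg _) (by norm_num)
                _ = _ := by ring
          _ ≤ _ := by linarith
  rw [← ENNReal.rpow_le_rpow_iff hq, ENNReal.mul_rpow_of_nonneg _ _ hq.le]
  refine (eLpNorm_weightedComp_rpow_le hp_top ht _).trans (mul_le_mul_right ?_ _)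
  refine (setLIntegral_mono' measurableSet_innerDisc hpt).trans
    ((setLIntegral_le_lintegral innerDisc _).trans ?_)
  have hmg : AEMeasurable (fun w => ‖bergmanEval g w‖ₑ ^ q) discArea :=
    ((aestronglyMeasurable_discArea hdg.continuousOn).enorm.pow_const q)
  rw [lintegral_add_right _ measurable_const, lintegral_add_left (by fun_prop),
    lintegral_const_mul _ (by fun_prop), lintegral_const_mul'' _ hmg, lintegral_const,
    measure_univ, mul_one, ← hI, ← eLpNorm_rpow_toReal hp_top, ← enorm_bergman, ← ofReal_norm,
    ENNReal.ofReal_rpow_of_nonneg (norm_nonneg _) hq.le, ← ENNReal.ofReal_toReal hIfin,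
    ENNReal.ofReal_rpow_of_nonneg (by positivity) hq.le, ← ENNReal.ofReal_mul (by positivity),
    ← ENNReal.ofReal_mul (by positivity), ← ENNReal.ofReal_add (by positivity) (by positivity),
    ← ENNReal.ofReal_add (by positivity) (by positivity)]
  refine ENNReal.ofReal_le_ofReal ?_
  calc (4 * ε * N) ^ q * I.toReal + 16 * (4 * η) ^ q * ‖g‖ ^ q + 16 * (2 * ε * N) ^ q
      ≤ (4 * ε * N) ^ q * I.toReal + 16 * (4 * η) ^ q * (6 * N) ^ q + 16 * (2 * ε * N) ^ q := by
        gcongr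
    _ = ((16 * 24 ^ q) * η ^ q + (4 ^ q * I.toReal + 16 * 2 ^ q) * ε ^ q) * N ^ q := by
        have hm : ∀ x y : ℝ, 0 ≤ x → 0 ≤ y → (x * y) ^ q = x ^ q * y ^ q := fun x y hx hy =>
          Real.mul_rpow hx hy
        rw [show (24 : ℝ) = 4 * 6 by norm_num, hm 4 6 (by norm_num) (by norm_num),
          hm _ N (by positivity) hN, hm 4 ε (by norm_num) hε.le, hm 4 η (by norm_num) hη.le,
          hm 6 N (by norm_num) hN, hm _ N (by positivity) hN, hm 2 ε (by norm_num) hε.le]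
        ring
    _ ≤ b ^ q * N ^ q := by
        gcongr
        linarith
    _ = (b * N) ^ q := (Real.mul_rpow hb.le hN).symm

/-! ### The upper bound for the essential norm -/

theorem essentialNorm_le {X : Type*} [NormedAddCommGroup X] [NormedSpace ℂ X] (T : X →L[ℂ] X)
    {K : X →L[ℂ] X} (hK : IsCompactOperator K) : essentialNorm T ≤ ‖T - K‖ :=
  csInf_le ⟨0, by rintro _ ⟨L, -, rfl⟩; exact norm_nonneg _⟩ ⟨K, hK, rfl⟩

theorem enorm_gammaTransform_le {μ : Measure ℝ} {T : BergmanSpace p →L[ℂ] BergmanSpace p}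
    [SFinite μ] (hp : 1 < p) (hp_top : p ≠ ∞) (hT : IsGammaOperator p μ T)
    (hμ : μ (Ico (0 : ℝ) 1)ᶜ = 0) (g : BergmanSpace p) {k : ℝ → ℝ≥0∞} (hk : Measurable k)
    (hk0 : ∀ t, k t ≠ 0) (hbound : ∀ t ∈ Ico (0 : ℝ) 1,
      eLpNorm (weightedComp t (bergmanEval g)) p discArea ≤ k t) (hfin : ∫⁻ t, k t ∂μ ≠ ∞) :
    ‖T g‖ₑ ≤ ∫⁻ t, k t ∂μ := by
  have hq1 : 1 < p.toReal := by
    simpa using (ENNReal.toReal_lt_toReal ENNReal.one_ne_top hp_top).2 hp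
  have hq : 0 < p.toReal := by linarith
  have hae : ∀ᵐ t ∂μ, t ∈ Ico (0 : ℝ) 1 := hμ
  classical
  -- `bergmanEval g` is arbitrary off the disc; cutting it off makes the integrand jointly
  -- measurable in `(t, z)`.
  set G : ℂ → ℂ := (ball 0 1).indicator (bergmanEval g) with hG
  have hGm : Measurable G :=
    (differentiableOn_bergmanEval g).continuousOn.measurable_piecewise continuousOn_const
      measurableSet_ball
  have hGeq : EqOn G (bergmanEval g) (ball 0 1) := fun z hz => indicator_of_mem hz _
  have hm : Measurable (Function.uncurry fun (t : ℝ) z => ‖weightedComp t G z‖ₑ) := by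
    unfold weightedComp
    have : Measurable fun x : ℝ × ℂ => 1 + ((x.1 : ℂ) - 1) * x.2 := by fun_prop
    have h2 : Measurable fun x : ℝ × ℂ => (x.1 : ℂ) / (1 + ((x.1 : ℂ) - 1) * x.2) := by fun_prop
    exact ((measurable_const.div this).mul (hGm.comp h2)).enorm
  have hmink := lintegral_lintegral_rpow_le (μ := μ) (ν := discArea) hq1 hm hk
    (ae_of_all _ hk0) (by
      filter_upwards [hae] with t ht
      rw [← eLpNorm_rpow_toReal hp_top, eLpNorm_discArea_congr (weightedComp_congr ht hGeq)]
      exact ENNReal.rpow_le_rpow (hbound t ht) hq.le) hfin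
  rw [← ENNReal.rpow_le_rpow_iff hq]
  refine le_trans ?_ hmink
  rw [enorm_bergman, eLpNorm_rpow_toReal hp_top]
  refine lintegral_mono_ae ?_
  filter_upwards [ae_discArea_mem_ball] with z hz
  refine ENNReal.rpow_le_rpow ?_ hq.le
  rw [(hT g z hz).2, gammaTransform]
  refine (enorm_integral_le_lintegral_enorm _).trans_eq (lintegral_congr_ae ?_)
  filter_upwards [hae] with t ht
  rw [weightedComp_congr ht hGeq hz]

theorem essentialNorm_le_lintegral (hp : 1 < p) (hp_top : p ≠ ∞) {μ : Measure ℝ}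
    [IsProbabilityMeasure μ] (hμ : μ (Ico (0 : ℝ) 1)ᶜ = 0)
    {T : BergmanSpace p →L[ℂ] BergmanSpace p} (hT : IsGammaOperator p μ T) :
    ENNReal.ofReal (essentialNorm T) ≤ ∫⁻ t, gammaWeight p.toReal t ∂μ := by
  set H := ∫⁻ t, gammaWeight p.toReal t ∂μ with hH
  rcases eq_or_ne H ∞ with hHtop | hHfin
  · simp [hHtop]
  rw [ENNReal.ofReal_le_iff_le_toReal hHfin]
  have key : ∀ b : ℝ, 0 < b → essentialNorm T ≤ (1 + b) * H.toReal + b := by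
    intro b hb
    obtain ⟨ρ, hρ, ε, hε, hW⟩ :=
      exists_eLpNorm_weightedComp_one_sub_pow_four_mul_le hp hp_top hb
    obtain ⟨S, hS, hSf⟩ := exists_compact_approx_id hp_top hρ hε
    have hu : DifferentiableOn ℂ (fun w : ℂ => 1 - w ^ 4) (ball 0 1) := by fun_prop
    obtain ⟨M, hM⟩ := exists_mul_bergman (p := p) hu (c := 2) fun z hz => by
      refine (norm_sub_le _ _).trans ?_
      rw [norm_one, norm_pow]
      linarith [pow_le_one₀ (n := 4) (norm_nonneg z) (mem_ball_zero_iff.1 hz).le]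
    -- The compact operator to subtract is `f ↦ T((1 - w^4) S f)`.
    have hK : IsCompactOperator (T ∘L (M ∘L S)) := (hS.clm_comp M).clm_comp T
    refine (essentialNorm_le T hK).trans ?_
    refine ContinuousLinearMap.opNorm_le_bound _ (by positivity) fun f => ?_
    rcases eq_or_ne f 0 with rfl | hf
    · simp
    have hN : 0 < ‖f‖ := norm_pos_iff.2 hf
    obtain ⟨h1, h2, h3⟩ := hSf f
    set g := f - S f with hg
    have hF : EqOn (bergmanEval (f - M (S f))) (fun w => w ^ 4 * bergmanEval f w +
        (1 - w ^ 4) * bergmanEval g w) (ball 0 1) := by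
      intro w hw
      simp only [bergmanEval_sub _ _ hw, Pi.sub_apply, hM _ hw, Pi.mul_apply, hg]
      ring
    have hTf : (T - T ∘L (M ∘L S)) f = T (f - M (S f)) := by simp
    rw [hTf]
    -- The constant summand keeps `k` nonzero, as Minkowski's inequality above requires, also where
    -- the weight vanishes (`t = 0`, `q < 2`). It adds only `b * ‖f‖`, as `μ` has mass one.
    set k : ℝ → ℝ≥0∞ := fun t => gammaWeight p.toReal t * ENNReal.ofReal ((1 + b) * ‖f‖) +
      ENNReal.ofReal (b * ‖f‖) with hk
    have hkint : ∫⁻ t, k t ∂μ = ENNReal.ofReal (((1 + b) * H.toReal + b) * ‖f‖) := by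
      rw [hk, lintegral_add_right _ measurable_const, lintegral_mul_const _
        (measurable_gammaWeight _), lintegral_const, measure_univ, mul_one, ← hH,
        ← ENNReal.ofReal_toReal hHfin, ← ENNReal.ofReal_mul (by positivity),
        ← ENNReal.ofReal_add (by positivity) (by positivity)]
      congr 1
      simp only [ENNReal.toReal_ofReal ENNReal.toReal_nonneg]
      ring
    have hkey : ‖T (f - M (S f))‖ₑ ≤ ∫⁻ t, k t ∂μ := by
      refine enorm_gammaTransform_le hp hp_top hT hμ _
        (((measurable_gammaWeight _).mul_const _).add_const _) (fun t => ?_) (fun t ht => ?_) ?_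
      · have : 0 < ENNReal.ofReal (b * ‖f‖) := ENNReal.ofReal_pos.2 (by positivity)
        exact (this.trans_le le_add_self).ne'
      · rw [eLpNorm_discArea_congr (weightedComp_congr ht hF)]
        -- `T_0 F` depends only on `F(0)`, which is `0` here; an atom of `μ` at `0` contributes
        -- nothing.
        rcases ht.1.eq_or_lt with rfl | ht0
        · have : weightedComp 0 (fun w => w ^ 4 * bergmanEval f w +
              (1 - w ^ 4) * bergmanEval g w) = 0 := by
            ext z
            simp [weightedComp, h2]
          rw [this]
          simp
        · have ht' : t ∈ Ioo (0 : ℝ) 1 := ⟨ht0, ht.2⟩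
          have hsplit : weightedComp t (fun w => w ^ 4 * bergmanEval f w +
              (1 - w ^ 4) * bergmanEval g w) = weightedComp t (fun w => w ^ 4 * bergmanEval f w) +
              weightedComp t (fun w => (1 - w ^ 4) * bergmanEval g w) := by
            ext z
            simp only [weightedComp, Pi.add_apply]
            ring
          have c1 := (differentiableOn_bergmanEval f).continuousOn
          have c2 := (differentiableOn_bergmanEval g).continuousOn
          rw [hsplit]
          refine (eLpNorm_add_le
            (aestronglyMeasurable_discArea (continuousOn_weightedComp ht (by fun_prop)))
            (aestronglyMeasurable_discArea (continuousOn_weightedComp ht (by fun_prop)))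
            Fact.out).trans ?_
          refine (add_le_add (eLpNorm_weightedComp_pow_four_mul_le hp_top ht' f)
            (hW g ‖f‖ hN.le h1 h2 h3 t ht')).trans ?_
          rw [← ofReal_norm, ← mul_add, ← ENNReal.ofReal_add hN.le (by positivity),
            show ‖f‖ + b * ‖f‖ = (1 + b) * ‖f‖ by ring]
          exact le_self_add
      · rw [hkint]
        exact ENNReal.ofReal_ne_top
    rw [hkint, ← ofReal_norm, ENNReal.ofReal_le_ofReal_iff (by positivity)] at hkey
    exact hkey
  refine le_of_forall_pos_le_add fun δ hδ => ?_
  have hpos : 0 < H.toReal + 1 := by positivity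
  refine (key (δ / (H.toReal + 1)) (by positivity)).trans_eq ?_
  field_simp
  ring

end

/-! ### Gliding hump -/

/-- If each `x n` is eventually almost disjoint from any given vector, then `0` is the only possible
limit of the images of a subsequence under a bounded operator. -/
theorem eq_zero_of_tendsto_map {X Y : Type*} [NormedAddCommGroup X] [NormedSpace ℂ X]
    [NormedAddCommGroup Y] [NormedSpace ℂ Y] (K : X →L[ℂ] Y) {q : ℝ} (hq : 1 < q) {x : ℕ → X}
    (hx : ∀ s, ∀ᶠ n in atTop, ‖s + x n‖ ^ q ≤ ‖s‖ ^ q + 2) {y : Y}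
    (hy : Tendsto (fun n => K (x n)) atTop (𝓝 y)) : y = 0 := by
  have hq0 : 0 < q := by linarith
  -- Greedy choice of `N` terms: their sum has norm at most `(2N)^(1/q)`, while its image is near `N
  -- y`. Since `q > 1`, dividing by `N` and letting `N → ∞` forces `y = 0`.
  have hsum : ∀ ε : ℝ, 0 < ε → ∀ N : ℕ, ∃ s : X, ‖s‖ ^ q ≤ 2 * N ∧ ‖K s - (N : ℂ) • y‖ ≤ N * ε := by
    intro ε hε N
    induction N with
    | zero => exact ⟨0, by simp [hq0.ne']⟩
    | succ N ih =>
      obtain ⟨s, hs1, hs2⟩ := ih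
      obtain ⟨n, hn1, hn2⟩ := ((hx s).and (hy.eventually (closedBall_mem_nhds y hε))).exists
      rw [dist_eq_norm] at hn2
      refine ⟨s + x n, hn1.trans (by push_cast; linarith), ?_⟩
      have : K (s + x n) - ((N + 1 : ℕ) : ℂ) • y = (K s - (N : ℂ) • y) + (K (x n) - y) := by
        rw [map_add]; push_cast; rw [add_smul, one_smul]; abel
      rw [this]
      refine (norm_add_le _ _).trans ?_
      push_cast
      linarith
  have hbound : ∀ ε : ℝ, 0 < ε → ∀ N : ℕ, 0 < N →
      ‖y‖ ≤ ε + ‖K‖ * 2 ^ (1 / q) * (N : ℝ) ^ (-(1 - 1 / q)) := by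
    intro ε hε N hN
    obtain ⟨s, hs1, hs2⟩ := hsum ε hε N
    have hN' : (0 : ℝ) < N := by exact_mod_cast hN
    have hs3 : ‖s‖ ≤ 2 ^ (1 / q) * (N : ℝ) ^ (1 / q) := by
      rw [← Real.mul_rpow (by norm_num) hN'.le]
      calc ‖s‖ = (‖s‖ ^ q) ^ (1 / q) := by
            rw [← Real.rpow_mul (norm_nonneg _), mul_one_div_cancel hq0.ne', Real.rpow_one]
        _ ≤ _ := Real.rpow_le_rpow (by positivity) hs1 (by positivity)
    have h1 : N * ‖y‖ ≤ N * ε + ‖K‖ * (2 ^ (1 / q) * (N : ℝ) ^ (1 / q)) := by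
      have h2 : ‖(N : ℂ) • y‖ = N * ‖y‖ := by rw [norm_smul, Complex.norm_natCast]
      rw [← h2]
      have h3 := norm_sub_norm_le ((N : ℂ) • y) (K s)
      rw [norm_sub_rev] at h3
      have h4 := K.le_opNorm s
      have h5 := mul_le_mul_of_nonneg_left hs3 (norm_nonneg K)
      linarith
    have h6 : (N : ℝ) ^ (1 / q) = N * (N : ℝ) ^ (-(1 - 1 / q)) := by
      conv_rhs => enter [1]; rw [← Real.rpow_one (N : ℝ)]
      rw [← Real.rpow_add hN']
      congr 1
      ring
    rw [h6] at h1
    refine le_of_mul_le_mul_left ?_ hN'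
    linarith
  have hlim : ∀ ε : ℝ, 0 < ε → ‖y‖ ≤ ε := by
    intro ε hε
    have hexp : 0 < 1 - 1 / q := by rw [sub_pos, div_lt_one hq0]; exact hq
    have ht : Tendsto (fun N : ℕ => ε + ‖K‖ * 2 ^ (1 / q) * (N : ℝ) ^ (-(1 - 1 / q))) atTop
        (𝓝 (ε + ‖K‖ * 2 ^ (1 / q) * 0)) :=
      (((tendsto_rpow_neg_atTop hexp).comp tendsto_natCast_atTop_atTop).const_mul _).const_add _
    rw [mul_zero, add_zero] at ht
    exact ge_of_tendsto ht (eventually_gt_atTop 0 |>.mono fun N hN => hbound ε hε N hN)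
  exact norm_le_zero_iff.1 (le_of_forall_pos_le_add fun ε hε => by simpa using hlim ε hε)

/-! ### Test functions and the action of `T_t` on them -/

/-- The test functions `(1 - z)^(-a)`. -/
def testFun (a : ℝ) (z : ℂ) : ℂ := (1 - z) ^ ((-a : ℝ) : ℂ)

theorem one_sub_ne_zero {z : ℂ} (hz : z ∈ ball (0 : ℂ) 1) : 1 - z ≠ 0 := fun h => by
  have := re_lt_one hz
  rw [← sub_eq_zero.1 h] at this
  simp at this

theorem re_one_sub_pos {z : ℂ} (hz : z ∈ ball (0 : ℂ) 1) : 0 < (1 - z).re := by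
  have := re_lt_one hz
  simpa using this

theorem differentiableOn_testFun (a : ℝ) : DifferentiableOn ℂ (testFun a) (ball 0 1) := by
  intro z hz
  refine DifferentiableAt.differentiableWithinAt ?_
  exact DifferentiableAt.cpow_const (by fun_prop) (Or.inl (re_one_sub_pos hz))

theorem norm_testFun (a : ℝ) (z : ℂ) : ‖testFun a z‖ = ‖1 - z‖ ^ (-a) :=
  Complex.norm_cpow_real _ _

theorem lintegral_testFun {q : ℝ} (hq : 0 < q) (a : ℝ) :
    ∫⁻ z, ‖testFun a z‖ₑ ^ q ∂discArea = ∫⁻ z, ENNReal.ofReal (‖1 - z‖ ^ (-(a * q))) ∂discArea := by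
  refine lintegral_congr fun z => ?_
  rw [← ofReal_norm, norm_testFun, ENNReal.ofReal_rpow_of_nonneg (by positivity) hq.le,
    ← Real.rpow_mul (norm_nonneg _), neg_mul]

theorem lintegral_testFun_lt_top {q : ℝ} (hq : 0 < q) {a : ℝ} (ha : a < 2 / q) :
    ∫⁻ z, ‖testFun a z‖ₑ ^ q ∂discArea < ∞ := by
  rw [lintegral_testFun hq, lintegral_discArea]
  rw [lt_div_iff₀ hq] at ha
  exact ENNReal.mul_lt_top (by simp [Real.pi_pos])
    (lintegral_ball_one_sub_norm_rpow_lt_top (by linarith))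

/-- Fatou's lemma together with the divergence at the critical exponent `-2`. -/
theorem tendsto_lintegral_testFun {q : ℝ} (hq : 0 < q) {a : ℕ → ℝ}
    (ha : Tendsto a atTop (𝓝 (2 / q))) :
    Tendsto (fun n => ∫⁻ z, ‖testFun (a n) z‖ₑ ^ q ∂discArea) atTop (𝓝 ∞) := by
  simp_rw [lintegral_testFun hq]
  have hlim : ∫⁻ z, liminf (fun n => ENNReal.ofReal (‖1 - z‖ ^ (-(a n * q)))) atTop ∂discArea = ∞ := by
    have : ∫⁻ z, ENNReal.ofReal (‖1 - z‖ ^ (-2 : ℝ)) ∂discArea = ∞ := by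
      rw [lintegral_discArea, lintegral_ball_one_sub_norm_neg_two, ENNReal.mul_top]
      simp
    rw [← this]
    refine lintegral_congr_ae ?_
    filter_upwards [ae_discArea_mem_ball] with z hz
    have h0 : 0 < ‖1 - z‖ := norm_pos_iff.2 (one_sub_ne_zero hz)
    refine Tendsto.liminf_eq (ENNReal.tendsto_ofReal ?_)
    have h2 : Tendsto (fun n => -(a n * q)) atTop (𝓝 (-2)) := by
      have := (ha.mul_const q).neg
      rwa [div_mul_cancel₀ _ hq.ne'] at this
    exact tendsto_const_nhds.rpow h2 (Or.inl h0.ne')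
  have h := lintegral_liminf_le' (μ := discArea) (u := atTop)
    (f := fun n z => ENNReal.ofReal (‖1 - z‖ ^ (-(a n * q)))) fun n => by fun_prop
  rw [hlim] at h
  exact tendsto_of_le_liminf_of_limsup_le h le_top

/-- The identity `1 - t/v = (1-t)(1-z)/v` factors the power. No branch correction appears because `1
- z` and `v` both lie in the right half-plane, so the arguments of `1 - z` and `v⁻¹` add up to less
than `π` in modulus. -/
theorem weightedComp_testFun {t : ℝ} (ht : t ∈ Ico (0 : ℝ) 1) (a : ℝ) {z : ℂ}
    (hz : z ∈ ball (0 : ℂ) 1) : weightedComp t (testFun a) z =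
      testFun a z * (((1 - t) ^ (-a) : ℝ) * (1 + ((t : ℂ) - 1) * z) ^ ((a - 1 : ℝ) : ℂ)) := by
  have hne := denom_ne_zero ht hz
  have hre := re_denom_pos ht hz
  have h1t : 0 < 1 - t := by linarith [ht.2]
  set v := 1 + ((t : ℂ) - 1) * z with hv
  have hu := re_one_sub_pos hz
  have hu0 := one_sub_ne_zero hz
  have hvarg : |v.arg| < Real.pi / 2 := Complex.abs_arg_lt_pi_div_two_iff.2 (Or.inl hre)
  have huarg : |(1 - z).arg| < Real.pi / 2 := Complex.abs_arg_lt_pi_div_two_iff.2 (Or.inl hu)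
  rw [abs_lt] at hvarg huarg
  have e1 : 1 - (t : ℂ) / v = ((1 - t : ℝ) : ℂ) * ((1 - z) * v⁻¹) := by
    push_cast
    field_simp
    rw [hv]
    ring
  have harg : v⁻¹.arg = -v.arg := by
    rw [Complex.arg_inv, if_neg]
    intro h
    rw [h] at hvarg
    linarith [Real.pi_pos]
  have hlog : Complex.log ((1 - z) * v⁻¹) = Complex.log (1 - z) - Complex.log v := by
    have h1 : v.arg ≠ Real.pi := fun h => by
      rw [h] at hvarg
      linarith [Real.pi_pos]
    have h2 : (1 - z).arg + v⁻¹.arg ∈ Ioc (-Real.pi) Real.pi := by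
      rw [harg]
      constructor <;> linarith
    rw [(Complex.log_mul_eq_add_log_iff hu0 (inv_ne_zero hne)).2 h2, Complex.log_inv _ h1]
    ring
  simp only [weightedComp, testFun, ← hv]
  have hr0 : ((1 - t : ℝ) : ℂ) ≠ 0 := by exact_mod_cast h1t.ne'
  have hw0 : (1 - z) * v⁻¹ ≠ 0 := mul_ne_zero hu0 (inv_ne_zero hne)
  rw [e1, Complex.cpow_def_of_ne_zero (mul_ne_zero hr0 hw0), Complex.log_ofReal_mul h1t hw0, hlog,
    Complex.cpow_def_of_ne_zero hu0, Complex.cpow_def_of_ne_zero hne, Real.rpow_def_of_pos h1t,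
    Complex.ofReal_exp, one_div]
  conv_lhs => enter [1]; rw [← Complex.exp_log hne, ← Complex.exp_neg]
  rw [← Complex.exp_add, ← Complex.exp_add, ← Complex.exp_add]
  congr 1
  push_cast
  ring

theorem re_cpow_nonneg {v : ℂ} (hv : 0 < v.re) {s : ℝ} (hs : |s| ≤ 1) : 0 ≤ (v ^ (s : ℂ)).re := by
  rw [Complex.cpow_ofReal_re]
  have hvarg : |v.arg| < Real.pi / 2 := Complex.abs_arg_lt_pi_div_two_iff.2 (Or.inl hv)
  refine mul_nonneg (by positivity) (Real.cos_nonneg_of_mem_Icc (abs_le.1 ?_))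
  rw [abs_mul]
  nlinarith [abs_nonneg s, abs_nonneg v.arg]


/-- The density whose integral bounds `Γ_μ` from below on the test functions. -/
def testDensity (x : ℝ × ℂ) (t : ℝ) : ℝ≥0∞ :=
  ENNReal.ofReal ((1 - t) ^ (-x.1) * ((1 + ((t : ℂ) - 1) * x.2) ^ ((x.1 - 1 : ℝ) : ℂ)).re)

theorem measurable_testDensity (x : ℝ × ℂ) : Measurable (testDensity x) := by
  unfold testDensity
  have h1 : Measurable fun t : ℝ => (1 + ((t : ℂ) - 1) * x.2) := by fun_prop
  have h2 : Measurable fun t : ℝ => (1 + ((t : ℂ) - 1) * x.2) ^ ((x.1 - 1 : ℝ) : ℂ) :=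
    h1.pow_const _
  have h3 : Measurable fun t : ℝ => (1 - t) ^ (-x.1) := by fun_prop
  exact (h3.mul (Complex.measurable_re.comp h2)).ennreal_ofReal

theorem tendsto_testDensity {q t : ℝ} (ht : t ∈ Ioo (0 : ℝ) 1) :
    Tendsto (fun x : ℝ × ℂ => testDensity x t) (𝓝 (2 / q, 1)) (𝓝 (gammaWeight q t)) := by
  have h1t : 0 < 1 - t := by linarith [ht.2]
  rw [gammaWeight_of_mem_Ioo ht]
  refine ENNReal.tendsto_ofReal ?_
  have hval : t ^ (2 / q - 1) / (1 - t) ^ (2 / q) = (1 - t) ^ (-(2 / q)) *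
      ((1 + ((t : ℂ) - 1) * 1) ^ ((2 / q - 1 : ℝ) : ℂ)).re := by
    rw [show 1 + ((t : ℂ) - 1) * 1 = (t : ℂ) by ring, ← Complex.ofReal_cpow ht.1.le,
      Complex.ofReal_re, Real.rpow_neg h1t.le]
    ring
  rw [hval]
  have hc1 : ContinuousAt (fun x : ℝ × ℂ => (1 - t) ^ (-x.1)) (2 / q, 1) :=
    continuousAt_const.rpow (by fun_prop) (Or.inl h1t.ne')
  have hc2 : ContinuousAt
      (fun x : ℝ × ℂ => (1 + ((t : ℂ) - 1) * x.2) ^ ((x.1 - 1 : ℝ) : ℂ)) (2 / q, 1) := by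
    refine ContinuousAt.cpow (by fun_prop) (by fun_prop) (Or.inl ?_)
    simp [ht.1]
  exact hc1.mul (Complex.continuous_re.continuousAt.comp hc2)

theorem gammaWeight_zero (q : ℝ) : gammaWeight q 0 = 0 ^ (2 / q - 1) := by
  simp [gammaWeight]

/-- At `t = 0` the denominator `v = 1 - z` tends to `0`, so continuity is not available. For `q < 2`
the weight is `0`. For `q ≥ 2` the argument of `v` stays below `π/2`, so the real part of `v^(a-1)`
is at least `|1-z|^(2/q-1) cos((1-a)π/2)`; this tends to `1` if `q = 2` and to `∞` if `q > 2`, the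
values of `0 ^ (2/q-1)` in `ℝ≥0∞`. -/
theorem gammaWeight_zero_le_liminf {q : ℝ} (hq : 1 < q) :
    gammaWeight q 0 ≤
      liminf (fun x : ℝ × ℂ => testDensity x 0) (𝓝[<] (2 / q) ×ˢ 𝓝[ball 0 1] 1) := by
  have hq0 : 0 < q := by linarith
  rcases lt_or_ge q 2 with h2 | h2
  · have : 0 < 2 / q - 1 := by rw [sub_pos, lt_div_iff₀ hq0]; linarith
    rw [gammaWeight_zero, ENNReal.zero_rpow_of_pos this]
    exact zero_le
  have hb1 : 2 / q ≤ 1 := by rw [div_le_one hq0]; exact h2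
  have hb0 : 0 < 2 / q := by positivity
  have hcl : (1 : ℂ) ∈ closure (ball (0 : ℂ) 1) := by
    rw [closure_ball _ one_ne_zero]; simp
  have : (𝓝[ball (0 : ℂ) 1] 1).NeBot := mem_closure_iff_nhdsWithin_neBot.1 hcl
  set l : Filter (ℝ × ℂ) := 𝓝[<] (2 / q) ×ˢ 𝓝[ball 0 1] 1 with hl
  set u : ℝ × ℂ → ℝ≥0∞ := fun x => ENNReal.ofReal ‖1 - x.2‖ ^ (2 / q - 1) *
    ENNReal.ofReal (Real.cos ((1 - x.1) * (Real.pi / 2))) with hu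
  have hcos : 0 < Real.cos ((1 - 2 / q) * (Real.pi / 2)) := by
    refine Real.cos_pos_of_mem_Ioo ⟨?_, ?_⟩ <;> nlinarith [Real.pi_pos]
  have hl1 : Tendsto Prod.fst l (𝓝 (2 / q)) := tendsto_fst.mono_right nhdsWithin_le_nhds
  have hl2 : Tendsto Prod.snd l (𝓝 1) := tendsto_snd.mono_right nhdsWithin_le_nhds
  have hu1 : Tendsto (fun x : ℝ × ℂ => ENNReal.ofReal ‖1 - x.2‖ ^ (2 / q - 1)) l
      (𝓝 (0 ^ (2 / q - 1))) := by
    have h1 : Tendsto (fun x : ℝ × ℂ => ENNReal.ofReal ‖1 - x.2‖) l (𝓝 0) := by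
      have : Tendsto (fun x : ℝ × ℂ => ‖1 - x.2‖) l (𝓝 ‖(1 : ℂ) - 1‖) :=
        (hl2.const_sub 1).norm
      simpa using ENNReal.tendsto_ofReal this
    exact (ENNReal.continuous_rpow_const.tendsto 0).comp h1
  have hu2 : Tendsto (fun x : ℝ × ℂ => ENNReal.ofReal (Real.cos ((1 - x.1) * (Real.pi / 2)))) l
      (𝓝 (ENNReal.ofReal (Real.cos ((1 - 2 / q) * (Real.pi / 2))))) :=
    ENNReal.tendsto_ofReal ((Real.continuous_cos.tendsto _).comp
      ((hl1.const_sub 1).mul_const _))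
  have hut : Tendsto u l (𝓝 (gammaWeight q 0)) := by
    have hprod : gammaWeight q 0 = 0 ^ (2 / q - 1) *
        ENNReal.ofReal (Real.cos ((1 - 2 / q) * (Real.pi / 2))) := by
      rw [gammaWeight_zero]
      rcases hb1.eq_or_lt with he | hlt
      · simp [he]
      · rw [ENNReal.zero_rpow_of_neg (by linarith), ENNReal.top_mul (ENNReal.ofReal_pos.2 hcos).ne']
    rw [hprod]
    refine ENNReal.Tendsto.mul hu1 (Or.inr ENNReal.ofReal_ne_top) hu2
      (Or.inl (ENNReal.ofReal_pos.2 hcos).ne')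
  have hle : u ≤ᶠ[l] fun x => testDensity x 0 := by
    have e1 : ∀ᶠ x in l, x.1 < 2 / q := tendsto_fst.eventually self_mem_nhdsWithin
    have e2 : ∀ᶠ x in l, 0 < x.1 := hl1.eventually (Ioi_mem_nhds hb0)
    have e3 : ∀ᶠ x in l, x.2 ∈ ball (0 : ℂ) 1 := tendsto_snd.eventually self_mem_nhdsWithin
    have e4 : ∀ᶠ x in l, x.2 ∈ ball (1 : ℂ) 1 := hl2.eventually (ball_mem_nhds _ one_pos)
    filter_upwards [e1, e2, e3, e4] with x h1 h2 h3 h4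
    have hn1 : ‖1 - x.2‖ < 1 := by rwa [mem_ball_iff_norm, norm_sub_rev] at h4
    have hn0 : 0 < ‖1 - x.2‖ := norm_pos_iff.2 (one_sub_ne_zero h3)
    have harg : |(1 - x.2).arg| < Real.pi / 2 :=
      Complex.abs_arg_lt_pi_div_two_iff.2 (Or.inl (re_one_sub_pos h3))
    simp only [hu, testDensity]
    rw [ENNReal.ofReal_rpow_of_pos hn0, ← ENNReal.ofReal_mul (by positivity)]
    refine ENNReal.ofReal_le_ofReal ?_
    rw [show 1 + (((0 : ℝ) : ℂ) - 1) * x.2 = 1 - x.2 by push_cast; ring, Complex.cpow_ofReal_re,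
      sub_zero, Real.one_rpow, one_mul]
    refine mul_le_mul (Real.rpow_le_rpow_of_exponent_ge hn0 hn1.le (by linarith)) ?_
      (Real.cos_nonneg_of_mem_Icc ⟨by nlinarith [Real.pi_pos], by nlinarith [Real.pi_pos]⟩)
      (by positivity)
    have habs : |(1 - x.2).arg * (x.1 - 1)| ≤ (1 - x.1) * (Real.pi / 2) := by
      rw [abs_mul, abs_of_nonpos (show x.1 - 1 ≤ 0 by linarith)]
      nlinarith
    rw [← Real.cos_abs ((1 - x.2).arg * (x.1 - 1))]
    exact Real.cos_le_cos_of_nonneg_of_le_pi (abs_nonneg _) (by nlinarith [Real.pi_pos]) habs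
  rw [← hut.liminf_eq]
  exact liminf_le_liminf hle

/-- Fatou's lemma along the filter `a ↑ 2/q`, `z → 1`; it needs neither domination nor finiteness of
the limit integral. -/
theorem eventually_lt_lintegral_testDensity {q : ℝ} (hq : 1 < q) {μ : Measure ℝ}
    (hμ : μ (Ico (0 : ℝ) 1)ᶜ = 0) {M : ℝ≥0∞} (hM : M < ∫⁻ t, gammaWeight q t ∂μ) :
    ∀ᶠ x in 𝓝[<] (2 / q) ×ˢ 𝓝[ball (0 : ℂ) 1] 1, M < ∫⁻ t, testDensity x t ∂μ := by
  have hcl : (1 : ℂ) ∈ closure (ball (0 : ℂ) 1) := by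
    rw [closure_ball _ one_ne_zero]; simp
  have : (𝓝[ball (0 : ℂ) 1] 1).NeBot := mem_closure_iff_nhdsWithin_neBot.1 hcl
  refine eventually_lt_of_lt_liminf (hM.trans_le ?_)
  refine le_trans (lintegral_mono_ae ?_)
    (lintegral_liminf_le (u := 𝓝[<] (2 / q) ×ˢ 𝓝[ball (0 : ℂ) 1] 1) measurable_testDensity)
  have hae : ∀ᵐ t ∂μ, t ∈ Ico (0 : ℝ) 1 := hμ
  filter_upwards [hae] with t ht
  rcases ht.1.eq_or_lt with rfl | ht0
  · exact gammaWeight_zero_le_liminf hq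
  · have h := (tendsto_testDensity (q := q) ⟨ht0, ht.2⟩).mono_left
      (show 𝓝[<] (2 / q) ×ˢ 𝓝[ball (0 : ℂ) 1] 1 ≤ 𝓝 (2 / q, 1) by
        rw [nhds_prod_eq]; exact Filter.prod_mono nhdsWithin_le_nhds nhdsWithin_le_nhds)
    exact h.liminf_eq.ge

/-- After `f_a(z)` is pulled out, the modulus of the remaining integral is at least its real part.
The range `0 ≤ a ≤ 2` gives `|a - 1| ≤ 1`, hence a nonnegative integrand. -/
theorem le_enorm_gammaTransform_testFun {μ : Measure ℝ} (hμ : μ (Ico (0 : ℝ) 1)ᶜ = 0) {a : ℝ}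
    (ha0 : 0 ≤ a) (ha2 : a ≤ 2) {z : ℂ} (hz : z ∈ ball (0 : ℂ) 1)
    (hint : Integrable (fun t : ℝ => weightedComp t (testFun a) z) μ) :
    (∫⁻ t, testDensity (a, z) t ∂μ) * ‖testFun a z‖ₑ ≤ ‖gammaTransform μ (testFun a) z‖ₑ := by
  have hae : ∀ᵐ t ∂μ, t ∈ Ico (0 : ℝ) 1 := hμ
  set d : ℝ → ℂ := fun t => ((1 - t) ^ (-a) : ℝ) * (1 + ((t : ℂ) - 1) * z) ^ ((a - 1 : ℝ) : ℂ) with hd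
  have hf0 : testFun a z ≠ 0 := by
    rw [← norm_pos_iff, norm_testFun]
    exact Real.rpow_pos_of_pos (norm_pos_iff.2 (one_sub_ne_zero hz)) _
  have heq : (fun t : ℝ => weightedComp t (testFun a) z) =ᵐ[μ] fun t => testFun a z * d t := by
    filter_upwards [hae] with t ht using weightedComp_testFun ht a hz
  have hdint : Integrable d μ := by
    have := (hint.congr heq).const_mul (testFun a z)⁻¹
    refine this.congr (ae_of_all _ fun t => ?_)
    simp only
    rw [inv_mul_cancel_left₀ hf0]
  have hre : ∀ t, (d t).re = (1 - t) ^ (-a) * ((1 + ((t : ℂ) - 1) * z) ^ ((a - 1 : ℝ) : ℂ)).re :=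
    fun t => Complex.re_ofReal_mul _ _
  have hnonneg : 0 ≤ᵐ[μ] fun t => (d t).re := by
    filter_upwards [hae] with t ht
    rw [hre]
    exact mul_nonneg (Real.rpow_nonneg (by linarith [ht.2]) _)
      (re_cpow_nonneg (re_denom_pos ht hz) (abs_le.2 ⟨by linarith, by linarith⟩))
  have hJ : ∫⁻ t, testDensity (a, z) t ∂μ = ENNReal.ofReal (∫ t, d t ∂μ).re := by
    have h1 : (∫ t, d t ∂μ).re = ∫ t, (d t).re ∂μ := (integral_re hdint).symm
    have h2 : Integrable (fun t => (d t).re) μ := hdint.re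
    rw [h1, ofReal_integral_eq_lintegral_ofReal h2 hnonneg]
    exact lintegral_congr fun t => by rw [hre]; rfl
  rw [gammaTransform, integral_congr_ae heq, integral_const_mul, enorm_mul, mul_comm, hJ]
  refine mul_le_mul_right ?_ _
  rw [← ofReal_norm]
  exact ENNReal.ofReal_le_ofReal (Complex.re_le_norm _)

/-! ### Concentration at `1` and the lower bound -/

section

variable {p : ℝ≥0∞} [Fact (1 ≤ p)]

/-- Normalized functions whose mass concentrates at the point `1` are eventually almost disjoint
from any given element of the Bergman space. -/
theorem eventually_norm_add_rpow_le (hp_top : p ≠ ∞) {x : ℕ → BergmanSpace p}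
    (hx1 : ∀ n, ‖x n‖ = 1)
    (hx : ∀ η > 0, Tendsto (fun n => ∫⁻ z in {z : ℂ | η ≤ ‖1 - z‖},
      ‖bergmanEval (x n) z‖ₑ ^ p.toReal ∂discArea) atTop (𝓝 0)) (s : BergmanSpace p) :
    ∀ᶠ n in atTop, ‖s + x n‖ ^ p.toReal ≤ ‖s‖ ^ p.toReal + 2 := by
  have hq1 := one_le_toReal hp_top
  have hq : 0 < p.toReal := by linarith
  set q := p.toReal with hqdef
  -- At `ε = 0` the left side is `1 + ‖s‖^q`, so the `2` leaves room. The two terms correspond to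
  -- the part near `1`, where `s` is small, and the part far from `1`, where `x n` is small.
  obtain ⟨ε, hε, hεq⟩ : ∃ ε : ℝ, 0 < ε ∧ (ε + 1) ^ q + (‖s‖ + ε) ^ q ≤ ‖s‖ ^ q + 2 := by
    have hc : ContinuousAt (fun ε : ℝ => (ε + 1) ^ q + (‖s‖ + ε) ^ q) 0 := by
      refine ContinuousAt.add ?_ ?_
      · exact ContinuousAt.rpow_const (by fun_prop) (Or.inr hq.le)
      · exact ContinuousAt.rpow_const (by fun_prop) (Or.inr hq.le)
    have h0 : (fun ε : ℝ => (ε + 1) ^ q + (‖s‖ + ε) ^ q) 0 < ‖s‖ ^ q + 2 := by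
      simp only [zero_add, Real.one_rpow, add_zero]
      linarith
    have h1 := (hc.eventually (Iio_mem_nhds h0)).filter_mono (nhdsWithin_le_nhds (s := Ioi 0))
    obtain ⟨ε, h2, h3⟩ := (h1.and self_mem_nhdsWithin).exists
    exact ⟨ε, h3, le_of_lt h2⟩
  have hmeas : ∀ f : BergmanSpace p, ∀ A : Set ℂ,
      AEStronglyMeasurable (bergmanEval f) (discArea.restrict A) := fun f A =>
    (aestronglyMeasurable_discArea (differentiableOn_bergmanEval f).continuousOn).restrict
  have hsfin : ∫⁻ z, ‖bergmanEval s z‖ₑ ^ q ∂discArea ≠ ∞ := by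
    rw [← eLpNorm_rpow_toReal hp_top, ← enorm_bergman]
    exact ENNReal.rpow_ne_top_of_nonneg hq.le enorm_ne_top
  have hε' : ENNReal.ofReal (ε ^ q) ≠ 0 := (ENNReal.ofReal_pos.2 (by positivity)).ne'
  obtain ⟨η, hη, hηs⟩ : ∃ η : ℝ, 0 < η ∧
      ∫⁻ z in {z : ℂ | η ≤ ‖1 - z‖}ᶜ, ‖bergmanEval s z‖ₑ ^ q ∂discArea ≤ ENNReal.ofReal (ε ^ q) := by
    obtain ⟨δ, hδ, hδs⟩ := exists_pos_setLIntegral_lt_of_measure_lt hsfin hε'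
    have ht : Tendsto (fun η : ℝ => discArea (closedBall (1 : ℂ) η)) (𝓝[>] 0) (𝓝 0) := by
      have hbd : ∀ η : ℝ, discArea (closedBall (1 : ℂ) η) ≤ ENNReal.ofReal η ^ 2 := by
        intro η
        rw [discArea, Measure.smul_apply, smul_eq_mul]
        calc _ ≤ (ENNReal.ofReal Real.pi)⁻¹ * volume (closedBall (1 : ℂ) η) :=
              mul_le_mul_right (Measure.restrict_apply_le _ _) _
          _ = _ := by
              rw [Complex.volume_closedBall, show (NNReal.pi : ℝ≥0∞) = ENNReal.ofReal Real.pi from by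
                rw [← NNReal.coe_real_pi, ENNReal.ofReal_coe_nnreal], mul_left_comm,
                ENNReal.inv_mul_cancel ofReal_pi_ne_zero ENNReal.ofReal_ne_top, mul_one]
      have h0 : Tendsto (fun η : ℝ => ENNReal.ofReal η ^ 2) (𝓝[>] 0) (𝓝 0) := by
        have : Tendsto (fun η : ℝ => ENNReal.ofReal η ^ 2) (𝓝 0) (𝓝 (ENNReal.ofReal 0 ^ 2)) :=
          ((ENNReal.continuous_pow 2).comp ENNReal.continuous_ofReal).tendsto 0
        simpa using this.mono_left nhdsWithin_le_nhds
      exact tendsto_of_tendsto_of_tendsto_of_le_of_le tendsto_const_nhds h0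
        (fun _ => zero_le) hbd
    obtain ⟨η, h1, h2⟩ := ((ht.eventually (Iio_mem_nhds hδ)).and self_mem_nhdsWithin).exists
    refine ⟨η, h2, (hδs _ (lt_of_le_of_lt (measure_mono fun z hz => ?_) h1)).le⟩
    have : ‖1 - z‖ < η := by simpa using hz
    rw [mem_closedBall_iff_norm, norm_sub_rev]
    exact this.le
  set A : Set ℂ := {z : ℂ | η ≤ ‖1 - z‖} with hA
  have hAm : MeasurableSet A := measurableSet_le measurable_const (by fun_prop)
  have hle : ∀ (f : BergmanSpace p) (B : Set ℂ) (c : ℝ), 0 ≤ c →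
      ∫⁻ z in B, ‖bergmanEval f z‖ₑ ^ q ∂discArea ≤ ENNReal.ofReal (c ^ q) →
      eLpNorm (bergmanEval f) p (discArea.restrict B) ≤ ENNReal.ofReal c := by
    intro f B c hc h
    rw [← ENNReal.rpow_le_rpow_iff hq, eLpNorm_rpow_toReal hp_top,
      ENNReal.ofReal_rpow_of_nonneg hc hq.le]
    exact h
  have hle' : ∀ (f : BergmanSpace p) (B : Set ℂ),
      eLpNorm (bergmanEval f) p (discArea.restrict B) ≤ ENNReal.ofReal ‖f‖ := by
    intro f B
    rw [ofReal_norm, enorm_bergman]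
    exact eLpNorm_mono_measure _ Measure.restrict_le_self
  have hev := (hx η hη).eventually (Iic_mem_nhds (pos_iff_ne_zero.2 hε'))
  filter_upwards [hev] with n hn
  have key : ∀ (B : Set ℂ) (c d : ℝ), 0 ≤ c → 0 ≤ d →
      eLpNorm (bergmanEval s) p (discArea.restrict B) ≤ ENNReal.ofReal c →
      eLpNorm (bergmanEval (x n)) p (discArea.restrict B) ≤ ENNReal.ofReal d →
      ∫⁻ z in B, ‖bergmanEval (s + x n) z‖ₑ ^ q ∂discArea ≤ ENNReal.ofReal ((c + d) ^ q) := by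
    intro B c d hc hd h1 h2
    have hcongr : eLpNorm (bergmanEval (s + x n)) p (discArea.restrict B) =
        eLpNorm (bergmanEval s + bergmanEval (x n)) p (discArea.restrict B) := by
      refine eLpNorm_congr_ae (ae_restrict_of_ae ?_)
      filter_upwards [ae_discArea_mem_ball] with z hz using bergmanEval_add _ _ hz
    rw [← eLpNorm_rpow_toReal hp_top, hcongr, ← ENNReal.ofReal_rpow_of_nonneg (by positivity) hq.le]
    refine ENNReal.rpow_le_rpow ?_ hq.le
    refine (eLpNorm_add_le (hmeas _ _) (hmeas _ _) Fact.out).trans ?_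
    rw [ENNReal.ofReal_add hc hd]
    exact add_le_add h1 h2
  have hfar := key A ‖s‖ ε (norm_nonneg _) hε.le (hle' s A) (hle _ A ε hε.le hn)
  have hnear := key Aᶜ ε 1 hε.le zero_le_one (hle _ _ ε hε.le hηs)
    (by simpa [hx1 n] using hle' (x n) Aᶜ)
  have htot : ‖s + x n‖ₑ ^ q ≤ ENNReal.ofReal ((‖s‖ + ε) ^ q) + ENNReal.ofReal ((ε + 1) ^ q) := by
    rw [enorm_bergman, eLpNorm_rpow_toReal hp_top, ← lintegral_add_compl _ hAm]
    exact add_le_add hfar hnear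
  rw [← ofReal_norm, ENNReal.ofReal_rpow_of_nonneg (norm_nonneg _) hq.le,
    ← ENNReal.ofReal_add (by positivity) (by positivity),
    ENNReal.ofReal_le_ofReal_iff (by positivity)] at htot
  linarith

theorem eLpNorm_testFun_lt_top (hp_top : p ≠ ∞) {a : ℝ} (ha : a < 2 / p.toReal) :
    eLpNorm (testFun a) p discArea < ∞ := by
  have hq : 0 < p.toReal := zero_lt_one.trans_le (one_le_toReal hp_top)
  have h := lintegral_testFun_lt_top hq ha
  rw [← eLpNorm_rpow_toReal hp_top] at h
  exact (ENNReal.rpow_lt_top_iff_of_pos hq).1 h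

/-- The normalized test functions `(1 - z)^(-a)` in the Bergman space. -/
def normalizedTestFun (p : ℝ≥0∞) [Fact (1 ≤ p)] (hp_top : p ≠ ∞) (a : ℝ) (ha : a < 2 / p.toReal) :
    BergmanSpace p :=
  ((‖bergmanOf (p := p) (testFun a) (differentiableOn_testFun a)
    (eLpNorm_testFun_lt_top hp_top ha)‖⁻¹ : ℝ) : ℂ) •
    bergmanOf (testFun a) (differentiableOn_testFun a) (eLpNorm_testFun_lt_top hp_top ha)

theorem enorm_bergmanOf_testFun_rpow (hp_top : p ≠ ∞) {a : ℝ} (ha : a < 2 / p.toReal) :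
    ‖bergmanOf (p := p) (testFun a) (differentiableOn_testFun a)
      (eLpNorm_testFun_lt_top hp_top ha)‖ₑ ^ p.toReal =
      ∫⁻ z, ‖testFun a z‖ₑ ^ p.toReal ∂discArea := by
  rw [enorm_bergmanOf, eLpNorm_rpow_toReal hp_top]

theorem bergmanOf_testFun_ne_zero (hp_top : p ≠ ∞) {a : ℝ} (ha : a < 2 / p.toReal) :
    bergmanOf (p := p) (testFun a) (differentiableOn_testFun a)
      (eLpNorm_testFun_lt_top hp_top ha) ≠ 0 := by
  intro h
  have h0 : (0 : ℂ) ∈ ball (0 : ℂ) 1 := by simp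
  have h1 := bergmanEval_bergmanOf (p := p) (differentiableOn_testFun a)
    (eLpNorm_testFun_lt_top hp_top ha) h0
  rw [h] at h1
  have h2 := bergmanEval_smul (p := p) 0 0 h0
  simp only [smul_zero, Pi.smul_apply, zero_smul] at h2
  rw [h2] at h1
  simp [testFun] at h1

theorem norm_normalizedTestFun (hp_top : p ≠ ∞) {a : ℝ} (ha : a < 2 / p.toReal) :
    ‖normalizedTestFun p hp_top a ha‖ = 1 := by
  rw [normalizedTestFun, norm_smul, Complex.norm_real, norm_inv, norm_norm]
  exact inv_mul_cancel₀ (norm_ne_zero_iff.2 (bergmanOf_testFun_ne_zero hp_top ha))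

theorem bergmanEval_normalizedTestFun (hp_top : p ≠ ∞) {a : ℝ} (ha : a < 2 / p.toReal) {z : ℂ}
    (hz : z ∈ ball (0 : ℂ) 1) : bergmanEval (normalizedTestFun p hp_top a ha) z =
      ((‖bergmanOf (p := p) (testFun a) (differentiableOn_testFun a)
        (eLpNorm_testFun_lt_top hp_top ha)‖⁻¹ : ℝ) : ℂ) * testFun a z := by
  rw [normalizedTestFun, bergmanEval_smul _ _ hz, Pi.smul_apply, bergmanEval_bergmanOf _ _ hz,
    smul_eq_mul]

/-- Away from `1` the functions `f_a` are bounded uniformly in `0 ≤ a ≤ 2`, while the normalizing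
integrals tend to infinity. -/
theorem tendsto_far_normalizedTestFun (hp_top : p ≠ ∞) {a : ℕ → ℝ} (ha : ∀ n, a n < 2 / p.toReal)
    (ha0 : ∀ n, 0 ≤ a n) (hlim : Tendsto a atTop (𝓝 (2 / p.toReal))) {η : ℝ} (hη : 0 < η) :
    Tendsto (fun n => ∫⁻ z in {z : ℂ | η ≤ ‖1 - z‖},
      ‖bergmanEval (normalizedTestFun p hp_top (a n) (ha n)) z‖ₑ ^ p.toReal ∂discArea)
      atTop (𝓝 0) := by
  have hq1 := one_le_toReal hp_top
  have hq : 0 < p.toReal := by linarith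
  set q := p.toReal with hqdef
  have hm : 0 < min η 1 := lt_min hη one_pos
  set C : ℝ≥0∞ := ENNReal.ofReal (min η 1 ^ (-2 : ℝ)) ^ q with hC
  have hCfin : C ≠ ∞ := ENNReal.rpow_ne_top_of_nonneg hq.le ENNReal.ofReal_ne_top
  have hbd : ∀ n, ∫⁻ z in {z : ℂ | η ≤ ‖1 - z‖},
      ‖bergmanEval (normalizedTestFun p hp_top (a n) (ha n)) z‖ₑ ^ q ∂discArea ≤
      (∫⁻ z, ‖testFun (a n) z‖ₑ ^ q ∂discArea)⁻¹ * C := by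
    intro n
    have hset : MeasurableSet {z : ℂ | η ≤ ‖1 - z‖} := measurableSet_le measurable_const (by fun_prop)
    calc _ ≤ ∫⁻ z in {z : ℂ | η ≤ ‖1 - z‖},
          (∫⁻ z, ‖testFun (a n) z‖ₑ ^ q ∂discArea)⁻¹ * C ∂discArea := by
          refine lintegral_mono_ae ?_
          filter_upwards [ae_restrict_of_ae ae_discArea_mem_ball, ae_restrict_mem hset] with z hz hz2
          rw [bergmanEval_normalizedTestFun _ _ hz, enorm_mul, ENNReal.mul_rpow_of_nonneg _ _ hq.le,
            ← enorm_bergmanOf_testFun_rpow hp_top (ha n)]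
          refine mul_le_mul' ?_ (ENNReal.rpow_le_rpow ?_ hq.le)
          · have hpos := norm_pos_iff.2 (bergmanOf_testFun_ne_zero hp_top (ha n))
            rw [← ofReal_norm, Complex.norm_real, Real.norm_of_nonneg (by positivity),
              ENNReal.ofReal_inv_of_pos hpos, ofReal_norm, ENNReal.inv_rpow]
          · rw [← ofReal_norm, norm_testFun]
            refine ENNReal.ofReal_le_ofReal ?_
            have hz3 : min η 1 ≤ ‖1 - z‖ := (min_le_left _ _).trans hz2
            have ha2 : a n ≤ 2 := (ha n).le.trans (by rw [div_le_iff₀ hq]; linarith)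
            calc ‖1 - z‖ ^ (-a n) ≤ min η 1 ^ (-a n) :=
                  Real.rpow_le_rpow_of_nonpos hm hz3 (by linarith [ha0 n])
              _ ≤ _ := Real.rpow_le_rpow_of_exponent_ge hm (min_le_right _ _) (by linarith)
      _ ≤ _ := by
          rw [lintegral_const]
          refine mul_le_of_le_one_right' ?_
          exact (Measure.restrict_apply_univ _).trans_le prob_le_one
  have h0 : Tendsto (fun n => (∫⁻ z, ‖testFun (a n) z‖ₑ ^ q ∂discArea)⁻¹ * C) atTop (𝓝 0) := by
    have h1 := tendsto_inv_iff.2 (tendsto_lintegral_testFun hq hlim)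
    have := ENNReal.Tendsto.mul_const h1 (b := C) (Or.inr hCfin)
    simpa using this
  exact tendsto_of_tendsto_of_tendsto_of_le_of_le tendsto_const_nhds h0 (fun _ => zero_le) hbd

theorem le_enorm_sub_of_isCompactOperator (hp : 1 < p) (hp_top : p ≠ ∞) {μ : Measure ℝ}
    (hμ : μ (Ico (0 : ℝ) 1)ᶜ = 0) {T K : BergmanSpace p →L[ℂ] BergmanSpace p}
    (hT : IsGammaOperator p μ T) (hK : IsCompactOperator K) :
    ∫⁻ t, gammaWeight p.toReal t ∂μ ≤ ‖T - K‖ₑ := by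
  have hq1 : 1 < p.toReal := by
    simpa using (ENNReal.toReal_lt_toReal ENNReal.one_ne_top hp_top).2 hp
  have hq : 0 < p.toReal := by linarith
  set q := p.toReal with hqdef
  refine le_of_forall_lt fun M hM => ?_
  obtain ⟨M', hM', hM'2⟩ := exists_between hM
  refine hM'.trans_le ?_
  clear hM hM' M
  rename' M' => M, hM'2 => hM
  have hMtop : M ≠ ∞ := hM.ne_top
  obtain ⟨η, hη, a₀, ha₀, hbound⟩ : ∃ η > 0, ∃ a₀ < 2 / q, ∀ a ∈ Ioo a₀ (2 / q),
      ∀ z ∈ ball (0 : ℂ) 1, ‖1 - z‖ < η → M < ∫⁻ t, testDensity (a, z) t ∂μ := by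
    obtain ⟨P, hP, Q, hQ, h⟩ :=
      eventually_prod_iff.1 (eventually_lt_lintegral_testDensity hq1 hμ hM)
    obtain ⟨a₀, ha₀, hP'⟩ := (mem_nhdsLT_iff_exists_Ioo_subset).1 hP
    obtain ⟨η, hη, hQ'⟩ := Metric.mem_nhdsWithin_iff.1 hQ
    refine ⟨η, hη, a₀, ha₀, fun a ha z hz hzη => h (hP' ha) (hQ' ⟨?_, hz⟩)⟩
    rwa [mem_ball_iff_norm, norm_sub_rev]
  have h2q : 0 < 2 / q := by positivity
  set b := max a₀ 0 with hb
  have hb2 : b < 2 / q := max_lt ha₀ h2q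
  obtain ⟨a, -, ha, hlim⟩ := exists_seq_strictMono_tendsto' hb2
  have ha1 : ∀ n, a n < 2 / q := fun n => (ha n).2
  have ha0 : ∀ n, 0 ≤ a n := fun n => (le_max_right a₀ 0).trans (ha n).1.le
  have haI : ∀ n, a n ∈ Ioo a₀ (2 / q) := fun n => ⟨(le_max_left a₀ 0).trans_lt (ha n).1, (ha n).2⟩
  set x : ℕ → BergmanSpace p := fun n => normalizedTestFun p hp_top (a n) (ha1 n) with hx
  have hx1 : ∀ n, ‖x n‖ = 1 := fun n => norm_normalizedTestFun hp_top (ha1 n)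
  have hfar : ∀ δ > 0, Tendsto (fun n => ∫⁻ z in {z : ℂ | δ ≤ ‖1 - z‖},
      ‖bergmanEval (x n) z‖ₑ ^ q ∂discArea) atTop (𝓝 0) := fun δ hδ =>
    tendsto_far_normalizedTestFun hp_top ha1 ha0 hlim hδ
  have hdisj := eventually_norm_add_rpow_le hp_top hx1 hfar
  obtain ⟨y, -, ψ, hψ, hy⟩ := (hK.isCompact_closure_image_closedBall 1).tendsto_subseq
    (x := fun n => K (x n)) fun n => subset_closure ⟨x n, by simp [hx1 n], rfl⟩
  have hy0 : y = 0 := eq_zero_of_tendsto_map K hq1 (x := x ∘ ψ)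
    (fun s => hψ.tendsto_atTop.eventually (hdisj s)) hy
  rw [hy0] at hy
  have hpt : ∀ n, ∀ z ∈ ball (0 : ℂ) 1, ‖1 - z‖ < η →
      M * ‖bergmanEval (x n) z‖ₑ ≤ ‖bergmanEval (T (x n)) z‖ₑ := by
    intro n z hz hzη
    have heval := bergmanEval_bergmanOf (p := p) (differentiableOn_testFun (a n))
      (eLpNorm_testFun_lt_top hp_top (ha1 n))
    set F := bergmanOf (p := p) (testFun (a n)) (differentiableOn_testFun (a n))
      (eLpNorm_testFun_lt_top hp_top (ha1 n)) with hF
    obtain ⟨hint, hTF⟩ := hT F z hz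
    have hae : ∀ᵐ t ∂μ, t ∈ Ico (0 : ℝ) 1 := hμ
    have hcongr : (fun t : ℝ => weightedComp t (bergmanEval F) z) =ᵐ[μ]
        fun t => weightedComp t (testFun (a n)) z := by
      filter_upwards [hae] with t ht using weightedComp_congr ht heval hz
    have ha2 : a n ≤ 2 := (ha1 n).le.trans (by rw [div_le_iff₀ hq]; linarith)
    have h1 := le_enorm_gammaTransform_testFun hμ (ha0 n) ha2 hz (hint.congr hcongr)
    have h2 : bergmanEval (T F) z = gammaTransform μ (testFun (a n)) z := by
      rw [hTF, gammaTransform, gammaTransform, integral_congr_ae hcongr]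
    have h3 : M * ‖testFun (a n) z‖ₑ ≤ ‖bergmanEval (T F) z‖ₑ := by
      rw [h2]
      exact (mul_le_mul_left (hbound _ (haI n) z hz hzη).le _).trans h1
    have h4 : bergmanEval (T (x n)) z = ((‖F‖⁻¹ : ℝ) : ℂ) * bergmanEval (T F) z := by
      have : T (x n) = ((‖F‖⁻¹ : ℝ) : ℂ) • T F := by
        rw [hx, ← map_smul]; rfl
      rw [this, bergmanEval_smul _ _ hz, Pi.smul_apply, smul_eq_mul]
    rw [h4, hx]
    simp only
    rw [bergmanEval_normalizedTestFun _ _ hz, enorm_mul, enorm_mul, mul_left_comm]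
    exact mul_le_mul_right h3 _
  -- Near `1`, `T` enlarges `x n` pointwise by `M`, and nearly all the mass of `x n` is there; on
  -- the right, `T = (T - K) + K`. Along the subsequence with `K (x n) → 0` this becomes `M ≤ ‖T -
  -- K‖`.
  have hlow : ∀ n, M ^ q * (1 - ∫⁻ z in {z : ℂ | η ≤ ‖1 - z‖},
      ‖bergmanEval (x n) z‖ₑ ^ q ∂discArea) ≤ (‖T - K‖ₑ + ‖K (x n)‖ₑ) ^ q := by
    intro n
    set A : Set ℂ := {z : ℂ | η ≤ ‖1 - z‖} with hA
    have hAm : MeasurableSet A := measurableSet_le measurable_const (by fun_prop)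
    have hone : ∫⁻ z, ‖bergmanEval (x n) z‖ₑ ^ q ∂discArea = 1 := by
      rw [← eLpNorm_rpow_toReal hp_top, ← enorm_bergman, ← ofReal_norm, hx1 n]
      simp
    have hsub : 1 - ∫⁻ z in A, ‖bergmanEval (x n) z‖ₑ ^ q ∂discArea ≤
        ∫⁻ z in Aᶜ, ‖bergmanEval (x n) z‖ₑ ^ q ∂discArea := by
      rw [tsub_le_iff_left, lintegral_add_compl _ hAm, hone]
    have hTn : ‖T (x n)‖ₑ ≤ ‖T - K‖ₑ + ‖K (x n)‖ₑ := by
      have h1 : T (x n) = (T - K) (x n) + K (x n) := by simp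
      have h2 := (T - K).le_opENorm (x n)
      have h3 : ‖x n‖ₑ = 1 := by rw [← ofReal_norm, hx1 n]; simp
      rw [h3, mul_one] at h2
      conv_lhs => rw [h1]
      exact (enorm_add_le _ _).trans (add_le_add_left h2 _)
    refine le_trans ?_ (ENNReal.rpow_le_rpow hTn hq.le)
    rw [enorm_bergman, eLpNorm_rpow_toReal hp_top]
    calc _ ≤ M ^ q * ∫⁻ z in Aᶜ, ‖bergmanEval (x n) z‖ₑ ^ q ∂discArea := mul_le_mul_right hsub _
      _ = ∫⁻ z in Aᶜ, (M * ‖bergmanEval (x n) z‖ₑ) ^ q ∂discArea := by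
          rw [← lintegral_const_mul' _ _ (ENNReal.rpow_ne_top_of_nonneg hq.le hMtop)]
          simp_rw [ENNReal.mul_rpow_of_nonneg _ _ hq.le]
      _ ≤ ∫⁻ z in Aᶜ, ‖bergmanEval (T (x n)) z‖ₑ ^ q ∂discArea := by
          refine lintegral_mono_ae ?_
          filter_upwards [ae_restrict_of_ae ae_discArea_mem_ball, ae_restrict_mem hAm.compl]
            with z hz hz2
          exact ENNReal.rpow_le_rpow (hpt n z hz (by simpa [hA] using hz2)) hq.le
      _ ≤ _ := setLIntegral_le_lintegral _ _
  have hMq : M ^ q ≠ ∞ := ENNReal.rpow_ne_top_of_nonneg hq.le hMtop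
  have hL : Tendsto (fun n => M ^ q * (1 - ∫⁻ z in {z : ℂ | η ≤ ‖1 - z‖},
      ‖bergmanEval (x (ψ n)) z‖ₑ ^ q ∂discArea)) atTop (𝓝 (M ^ q * (1 - 0))) :=
    ENNReal.Tendsto.const_mul (ENNReal.Tendsto.sub tendsto_const_nhds
      ((hfar η hη).comp hψ.tendsto_atTop) (Or.inl ENNReal.one_ne_top)) (Or.inr hMq)
  have hR : Tendsto (fun n => (‖T - K‖ₑ + ‖K (x (ψ n))‖ₑ) ^ q) atTop
      (𝓝 ((‖T - K‖ₑ + ‖(0 : BergmanSpace p)‖ₑ) ^ q)) :=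
    (ENNReal.continuous_rpow_const.tendsto _).comp (tendsto_const_nhds.add hy.enorm)
  have hfinal := le_of_tendsto_of_tendsto' hL hR fun n => hlow (ψ n)
  have h0 : ‖(0 : BergmanSpace p)‖ₑ = 0 := enorm_zero
  rw [tsub_zero, mul_one, h0, add_zero, ENNReal.rpow_le_rpow_iff hq] at hfinal
  exact hfinal

theorem lintegral_le_essentialNorm (hp : 1 < p) (hp_top : p ≠ ∞) {μ : Measure ℝ}
    (hμ : μ (Ico (0 : ℝ) 1)ᶜ = 0) {T : BergmanSpace p →L[ℂ] BergmanSpace p}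
    (hT : IsGammaOperator p μ T) :
    ∫⁻ t, gammaWeight p.toReal t ∂μ ≤ ENNReal.ofReal (essentialNorm T) := by
  have h0 := le_enorm_sub_of_isCompactOperator hp hp_top hμ hT
    (K := 0) (isCompactOperator_zero (M₁ := BergmanSpace p) (M₂ := BergmanSpace p))
  have hfin : ∫⁻ t, gammaWeight p.toReal t ∂μ ≠ ∞ := (h0.trans_lt enorm_lt_top).ne
  rw [← ENNReal.ofReal_toReal hfin]
  refine ENNReal.ofReal_le_ofReal (le_csInf ⟨_, 0, isCompactOperator_zero, rfl⟩ ?_)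
  rintro _ ⟨K, hK, rfl⟩
  have h := le_enorm_sub_of_isCompactOperator hp hp_top hμ hT hK
  rw [← ofReal_norm] at h
  exact ENNReal.toReal_le_of_le_ofReal (T - K).opNorm_nonneg h

/-! ### Compactness -/

/-- For `p < 2` the operator `Γ_μ` of the point mass at `0` has rank one. -/
theorem exists_isGammaOperator_dirac_zero (hp2 : p < 2) (hp_top : p ≠ ∞) :
    ∃ T : BergmanSpace p →L[ℂ] BergmanSpace p,
      IsGammaOperator p (Measure.dirac 0) T ∧ IsCompactOperator T := by
  have hq1 := one_le_toReal hp_top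
  have hq2 : p.toReal < 2 := by
    simpa using (ENNReal.toReal_lt_toReal hp_top ENNReal.ofNat_ne_top).2 hp2
  have ha : (1 : ℝ) < 2 / p.toReal := by rw [lt_div_iff₀ (by linarith)]; linarith
  obtain ⟨e, he⟩ := exists_taylorCoeff (p := p) 0
  set F := bergmanOf (p := p) (testFun 1) (differentiableOn_testFun 1)
    (eLpNorm_testFun_lt_top hp_top ha) with hF
  refine ⟨e.smulRight F, fun f z hz => ⟨?_, ?_⟩, isCompactOperator_smulRight _ _⟩
  · exact integrable_dirac (by simp)
  · rw [gammaTransform, integral_dirac, ContinuousLinearMap.smulRight_apply,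
      bergmanEval_smul _ _ hz, Pi.smul_apply, hF, bergmanEval_bergmanOf _ _ hz, he]
    simp [testFun, weightedComp, Complex.cpow_neg_one]
    ring_nf

/-- At `t = 0` the weight is `0 ^ (2/q-1)`, which is `1` or `∞` as soon as the exponent is not
positive. -/
theorem gammaWeight_ne_zero {q t : ℝ} (hq : 0 < q) (ht : t ∈ Ico (0 : ℝ) 1) (h : 0 < t ∨ 2 ≤ q) :
    gammaWeight q t ≠ 0 := by
  rcases ht.1.eq_or_lt with rfl | h0
  · have h2 : 2 ≤ q := h.resolve_left (lt_irrefl _)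
    have : 2 / q - 1 ≤ 0 := by rw [sub_nonpos, div_le_one hq]; exact h2
    rw [gammaWeight_zero]
    intro h
    rw [ENNReal.rpow_eq_zero_iff] at h
    rcases h with h | h
    · linarith [h.2]
    · exact ENNReal.zero_ne_top h.1
  · rw [gammaWeight_of_mem_Ioo ⟨h0, ht.2⟩]
    have : 0 < 1 - t := by linarith [ht.2]
    exact (ENNReal.ofReal_pos.2 (by positivity)).ne'

theorem ae_gammaWeight_eq_zero (hp : 1 < p) (hp_top : p ≠ ∞) {μ : Measure ℝ}
    (hμ : μ (Ico (0 : ℝ) 1)ᶜ = 0) {T : BergmanSpace p →L[ℂ] BergmanSpace p}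
    (hT : IsGammaOperator p μ T) (hTc : IsCompactOperator T) :
    ∀ᵐ t ∂μ, gammaWeight p.toReal t = 0 := by
  have h := le_enorm_sub_of_isCompactOperator hp hp_top hμ hT hTc
  have h0 : ‖(0 : BergmanSpace p →L[ℂ] BergmanSpace p)‖ₑ = 0 := by
    rw [← ofReal_norm]
    exact (congrArg ENNReal.ofReal ContinuousLinearMap.opNorm_zero).trans ENNReal.ofReal_zero
  rw [sub_self, h0, nonpos_iff_eq_zero,
    lintegral_eq_zero_iff (measurable_gammaWeight _)] at h
  exact h

end
end

theorem theorem2 (p : ℝ≥0∞) [Fact (1 ≤ p)] (hp : 1 < p) (hp_top : p ≠ ∞)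
    (μ : Measure ℝ) [IsProbabilityMeasure μ] (hμ : μ (Set.Ico (0 : ℝ) 1)ᶜ = 0) :
    (∀ T : BergmanSpace p →L[ℂ] BergmanSpace p, IsGammaOperator p μ T →
      ENNReal.ofReal (essentialNorm T) =
        ∫⁻ t, ENNReal.ofReal t ^ (2 / p.toReal - 1) / ENNReal.ofReal (1 - t) ^ (2 / p.toReal) ∂μ) ∧
    (2 ≤ p →
      ¬ ∃ T : BergmanSpace p →L[ℂ] BergmanSpace p, IsGammaOperator p μ T ∧ IsCompactOperator T) ∧
    (p < 2 →
      ((∃ T : BergmanSpace p →L[ℂ] BergmanSpace p, IsGammaOperator p μ T ∧ IsCompactOperator T) ↔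
        μ = Measure.dirac 0)) := by
  have hq : 0 < p.toReal := zero_lt_one.trans_le (one_le_toReal hp_top)
  have hae : ∀ᵐ t ∂μ, t ∈ Set.Ico (0 : ℝ) 1 := hμ
  refine ⟨fun T hT => le_antisymm (essentialNorm_le_lintegral hp hp_top hμ hT)
    (lintegral_le_essentialNorm hp hp_top hμ hT), ?_, ?_⟩
  · rintro h2 ⟨T, hT, hTc⟩
    have hq2 : 2 ≤ p.toReal := by simpa using ENNReal.toReal_mono hp_top h2
    obtain ⟨t, ht, ht0⟩ := (hae.and (ae_gammaWeight_eq_zero hp hp_top hμ hT hTc)).exists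
    exact gammaWeight_ne_zero hq ht (Or.inr hq2) ht0
  · refine fun h2 => ⟨?_, ?_⟩
    · rintro ⟨T, hT, hTc⟩
      have h0 : ∀ᵐ t ∂μ, t = 0 := by
        filter_upwards [hae, ae_gammaWeight_eq_zero hp hp_top hμ hT hTc] with t ht ht0
        by_contra hne
        exact gammaWeight_ne_zero hq ht (Or.inl (lt_of_le_of_ne ht.1 (Ne.symm hne))) ht0
      refine Measure.ext fun s hs => ?_
      rw [Measure.dirac_apply' _ hs]
      by_cases h0s : (0 : ℝ) ∈ s
      · rw [Set.indicator_of_mem h0s, Pi.one_apply, ← mem_ae_iff_prob_eq_one hs]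
        filter_upwards [h0] with t ht
        rwa [ht]
      · rw [Set.indicator_of_notMem h0s]
        refine measure_mono_null (fun t ht => ?_) (show μ {t | ¬ t = 0} = 0 from h0)
        rintro rfl
        exact h0s ht
    · rintro rfl
      exact exists_isGammaOperator_dirac_zero h2 hp_top
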